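/- Use polar coordinates $(r,\theta)$ on $\mathbb{R}^2$ with $\boldsymbol{\nu}=\langle\cos\theta,\sin\theta\rangle$, $\boldsymbol{\tau}=\langle-\sin\theta,\cos\theta\rangle$, and let $\mathbb{T}=\mathbb{R}/2\pi\mathbb{Z}$. Let $0<\lambda<\frac12$ and let $\psi\in H^1(\mathbb{T})$ be real valued (identified with its continuous representative). Put $\Psi(r,\theta)=r^{\lambda}\psi(\theta)$ and $$\mathbf{u}=\nabla^{\perp}\Psi=r^{\lambda-1}\left[\lambda\,\psi(\theta)\,\boldsymbol{\tau}-\psi'(\theta)\,\boldsymbol{\nu}\right],$$ where $\psi'\in L^2(\mathbb{T})$ is the weak derivative. Suppose that $\mathbf{u}$ is a weak solution of the stationary Euler equations $\mathbf{u}\cdot\nabla\mathbf{u}+\nabla p=0$, $\nabla\cdot\mathbf{u}=0$ on $\mathbb{R}^2\setminus\{0\}$ for some pressure distribution $p\in\mathcal{D}'(\mathbb{R}^2\setminus\{0\})$, that is, $$\int \mathbf{u}\cdot\nabla\mathbf{v}\cdot\mathbf{u}\,dx+\langle p,\nabla\cdot\mathbf{v}\rangle=0\quad\text{for all }\mathbf{v}\in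 C_0^\infty(\mathbb{R}^2\setminus\{0\};\mathbb{R}^2),$$ $$\int\mathbf{u}\cdot\nabla\eta\,dx=0\quad\text{for all }\eta\in C_0^\infty(\mathbb{R}^2\setminus\{0\}).$$ Then the flow is trivial, that is, either a rotational flow ($\psi$ is constant) or a parallel shear flow (up to a rotation, $\Psi=|x|^{\lambda}(A\chi_{\{x>0\}}+B\chi_{\{x\le0\}})$ with $A,B\in\mathbb{R}$). More precisely: 1. either $\psi\equiv0$ or $\psi$ is elliptic, i.e. vanishes nowhere; 2. $\psi$ is not hyperbolic, i.e. it is not the case that $\psi$ vanishes at two or more points of $\mathbb{T}$ without the flow being a parallel shear flow; 3. $\psi$ is not parabolic, i.e. $\psi$ does not vanish at exactly one point of $\mathbb{T}$; 4. if $\psi$ is elliptic, then $\psi$ is constant. -/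

import Mathlib

open scoped Real Distributions ContDiff

noncomputable section

namespace HomEuler

/-! ### The plane and polar coordinates

The plane `ℝ²` is identified with `ℂ`, as a real inner product space with Lebesgue measure. A function
of the angle is a `2π`-periodic function `ℝ → ℝ`. -/

/-- The radial unit vector `ν = ⟨cos θ, sin θ⟩`. -/
def radialVec (θ : ℝ) : ℂ := ⟨Real.cos θ, Real.sin θ⟩

/-- The angular unit vector `τ = ⟨-sin θ, cos θ⟩`. -/
def angularVec (θ : ℝ) : ℂ := ⟨-Real.sin θ, Real.cos θ⟩

/-- The plane without the origin. -/
def puncturedPlane : TopologicalSpace.Opens ℂ := ⟨{0}ᶜ, isOpen_compl_singleton⟩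

/-! ### The stationary Euler equation in the weak sense -/

/-- The divergence of a compactly supported smooth vector field `v`,
`∇ · v = ∂₁ v₁ + ∂₂ v₂`, as a test function. -/
def divergence {Ω : TopologicalSpace.Opens ℂ} (v : 𝓓(Ω, ℂ)) : 𝓓(Ω, ℝ) :=
  TestFunction.postcompCLM (𝕜 := ℝ) Complex.reCLM (TestFunction.lineDerivCLM ℝ (1 : ℂ) v) +
    TestFunction.postcompCLM (𝕜 := ℝ) Complex.imCLM (TestFunction.lineDerivCLM ℝ Complex.I v)

/-- `divergence` is the usual pointwise divergence. -/
theorem divergence_apply {Ω : TopologicalSpace.Opens ℂ} (v : 𝓓(Ω, ℂ)) (z : ℂ) :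
    divergence v z = (fderiv ℝ v z 1).re + (fderiv ℝ v z Complex.I).im := by
  have h : DifferentiableAt ℝ v z := (v.contDiff.differentiable (by simp)).differentiableAt
  simp [divergence, h.lineDeriv_eq_fderiv]

/-- The pair of a velocity field `u` and a pressure distribution `p` solves the stationary Euler system
`u · ∇u + ∇p = 0`, `∇ · u = 0` in the open set `Ω` in the weak sense. -/
structure IsWeakStationaryEuler (Ω : TopologicalSpace.Opens ℂ) (u : ℂ → ℂ) (p : 𝓓'(Ω, ℝ)) :
    Prop where
  /-- `u` is measurable and locally square integrable in `Ω`. -/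
  aestronglyMeasurable : MeasureTheory.AEStronglyMeasurable u (MeasureTheory.volume.restrict Ω)
  locallyIntegrableOn_sq : MeasureTheory.LocallyIntegrableOn (fun z => ‖u z‖ ^ 2) Ω
  /-- `∇ · u = 0` : `∫ u · ∇η = 0` for all scalar test functions `η`. -/
  incompressible : ∀ η : 𝓓(Ω, ℝ), ∫ z, fderiv ℝ η z (u z) = 0
  /-- `u · ∇u + ∇p = 0` : `∫ u · ∇v · u + p(∇ · v) = 0` for all test fields `v`. -/
  momentum : ∀ v : 𝓓(Ω, ℂ), (∫ z, inner ℝ (fderiv ℝ v z (u z)) (u z)) + p (divergence v) = 0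

/-! ### Homogeneous flows -/

/-- `ψ ∈ H¹(𝕋)`, given by its continuous representative, with weak derivative `dψ ∈ L²(𝕋)`. -/
structure IsH1Circle (ψ dψ : ℝ → ℝ) : Prop where
  periodic : Function.Periodic ψ (2 * π)
  continuous : Continuous ψ
  deriv_periodic : Function.Periodic dψ (2 * π)
  deriv_memLp : MeasureTheory.MemLp dψ 2 (MeasureTheory.volume.restrict (Set.Ioc (-π) π))
  weak_deriv : ∀ φ : ℝ → ℝ, ContDiff ℝ ∞ φ → Function.Periodic φ (2 * π) →
    ∫ θ in (-π)..π, ψ θ * deriv φ θ = -∫ θ in (-π)..π, dψ θ * φ θ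

/-- The velocity `u = ∇^⊥ Ψ = r ^ (λ - 1) (λ ψ τ - ψ' ν)` of the homogeneous stream function
`Ψ = r ^ λ ψ(θ)`; here `dψ` stands for `ψ'`. -/
def homVelocity (lam : ℝ) (ψ dψ : ℝ → ℝ) (z : ℂ) : ℂ :=
  (‖z‖ ^ (lam - 1)) •
    ((lam * ψ z.arg) • angularVec z.arg - dψ z.arg • radialVec z.arg)

/-- Rotational flow: `ψ` is constant. -/
def IsRotational (ψ : ℝ → ℝ) : Prop := ∃ c : ℝ, ∀ θ, ψ θ = c

open Classical in
/-- Parallel shear flow: up to a rotation, `Ψ = |x| ^ λ (A χ_{x > 0} + B χ_{x ≤ 0})`. -/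
def IsParallelShear (lam : ℝ) (ψ : ℝ → ℝ) : Prop :=
  ∃ A B θ₀ : ℝ, ∀ θ,
    ψ θ = |Real.cos (θ - θ₀)| ^ lam * (if 0 < Real.cos (θ - θ₀) then A else B)

/-- Trivial flows. -/
def IsTrivial (lam : ℝ) (ψ : ℝ → ℝ) : Prop := IsRotational ψ ∨ IsParallelShear lam ψ

/-- Elliptic type: `ψ` does not vanish. -/
def IsElliptic (ψ : ℝ → ℝ) : Prop := ∀ θ, ψ θ ≠ 0

/-- Parabolic type: `ψ` vanishes at exactly one point of the circle. -/
def IsParabolic (ψ : ℝ → ℝ) : Prop := ∃! θ, θ ∈ Set.Ioc (-π) π ∧ ψ θ = 0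

/-- Hyperbolic type: `ψ` vanishes at two or more points of the circle and the flow is not a
parallel shear flow. -/
def IsHyperbolic (lam : ℝ) (ψ : ℝ → ℝ) : Prop :=
  (∃ θ₁ ∈ Set.Ioc (-π) π, ∃ θ₂ ∈ Set.Ioc (-π) π, θ₁ ≠ θ₂ ∧ ψ θ₁ = 0 ∧ ψ θ₂ = 0) ∧
    ¬ IsParallelShear lam ψ

end HomEuler

end

noncomputable section
namespace HomEuler

open MeasureTheory intervalIntegral

/-! ### Fourier series of real functions on `[-π, π]` -/

/-! In the range `0 < λ < 1/2` the weak equation forces `ψ` to be constant, and every assertion is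
read off from that.

The pressure disappears when the momentum equation is tested with `∇^⊥ η`, where `η` is a radial
cutoff times a single angular mode. In polar coordinates the integrals factor, and integration by
parts in `r` turns every radial factor into a multiple of one positive integral. What remains are
the nonconstant Fourier modes of an equation for `ψ`, which integrates once to `λ (ψψ')' = (2λ - 1)
ψ'² - λ² ψ² - k`, with `k` constant. So `ψψ'` agrees a.e. with an absolutely continuous function,
and multiplying by `F(ψ)` and integrating by parts gives `∫ ψ'² (λ ψ F'(ψ) + (2λ - 1) F(ψ)) = ∫ (λ²
ψ² + k) F(ψ)`.

Put `γ = 1/λ > 2` and `q = |ψ|^γ`, with mean `m`. For `F(s) = |s|^(γ-2)` the bracket on the left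
vanishes formally; a regularization yields `2πλ²m + k ∫ |ψ|^(γ-2) ≤ 0`. For `F(s) = |s|^(2γ-2)` the
bracket is `F` itself, so the left side is `λ² ∫ q'²`, and Wirtinger's inequality for `q` gives
`-2πλ²m² ≤ k ∫ |ψ|^(2γ-2)`. If `m > 0`, then `k < 0` and the two bounds combine to `∫ |ψ|^(γ-2) q ≤
m ∫ |ψ|^(γ-2)`. This is the reverse of Chebyshev's inequality for two strictly increasing functions
of `|ψ|`, so `|ψ|` is constant; by continuity so is `ψ`.

The weight is carried by `IsWeakStationaryEuler.mode_identity`,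
`IsModeSolution.exists_profile_equation`, `IsModeSolution.exists_energy_relations` and
`IsModeSolution.exists_abs_eq`. -/

theorem neg_pi_lt_pi : -π < π := by linarith [Real.pi_pos]

theorem intervalIntegrable_of_memLp_two {f : ℝ → ℝ}
    (hf : MemLp f 2 (volume.restrict (Set.Ioc (-π) π))) :
    IntervalIntegrable f volume (-π) π := by
  rw [intervalIntegrable_iff_integrableOn_Ioc_of_le neg_pi_lt_pi.le]
  exact hf.integrable (by norm_num)

theorem fourierCoeffOn_ofReal {f : ℝ → ℝ} (hf : IntervalIntegrable f volume (-π) π) (n : ℤ) :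
    fourierCoeffOn neg_pi_lt_pi (fun x => (f x : ℂ)) n =
      ((1 / (2 * π) * ∫ x in (-π)..π, f x * Real.cos (n * x) : ℝ) : ℂ) -
      ((1 / (2 * π) * ∫ x in (-π)..π, f x * Real.sin (n * x) : ℝ) : ℂ) * Complex.I := by
  have hc : IntervalIntegrable (fun x => f x * Real.cos (n * x)) volume (-π) π :=
    hf.mul_continuousOn (by fun_prop)
  have hs : IntervalIntegrable (fun x => f x * Real.sin (n * x)) volume (-π) π :=
    hf.mul_continuousOn (by fun_prop)
  have key : ∀ x : ℝ, fourier (-n) (x : AddCircle (π - -π)) • (f x : ℂ) =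
      ((f x * Real.cos (n * x) : ℝ) : ℂ) - ((f x * Real.sin (n * x) : ℝ) : ℂ) * Complex.I := by
    intro x
    rw [fourier_coe_apply, smul_eq_mul]
    have : 2 * (π : ℂ) * Complex.I * ((-n : ℤ) : ℂ) * x / ((π - -π : ℝ) : ℂ) =
        ((-(n * x) : ℝ) : ℂ) * Complex.I := by
      have hpi : (π : ℂ) ≠ 0 := by exact_mod_cast Real.pi_ne_zero
      push_cast
      field_simp
      ring
    rw [this, Complex.exp_mul_I, ← Complex.ofReal_cos, ← Complex.ofReal_sin, Real.cos_neg,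
      Real.sin_neg]
    push_cast
    ring
  rw [fourierCoeffOn_eq_integral]
  simp_rw [key]
  have hc' : IntervalIntegrable (fun x => ((f x * Real.cos (n * x) : ℝ) : ℂ)) volume (-π) π :=
    ⟨hc.1.ofReal, hc.2.ofReal⟩
  have hs' : IntervalIntegrable (fun x => ((f x * Real.sin (n * x) : ℝ) : ℂ)) volume (-π) π :=
    ⟨hs.1.ofReal, hs.2.ofReal⟩
  rw [intervalIntegral.integral_sub hc' (hs'.mul_const _),
    intervalIntegral.integral_mul_const, intervalIntegral.integral_ofReal,
    intervalIntegral.integral_ofReal, Complex.real_smul]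
  push_cast
  ring

/-- Parseval's identity in real form. -/
theorem hasSum_sq_cos_sin {f : ℝ → ℝ} (hf : MemLp f 2 (volume.restrict (Set.Ioc (-π) π))) :
    HasSum (fun n : ℤ => 1 / (2 * π) * ((∫ x in (-π)..π, f x * Real.cos (n * x)) ^ 2 +
      (∫ x in (-π)..π, f x * Real.sin (n * x)) ^ 2)) (∫ x in (-π)..π, f x ^ 2) := by
  have hpi := Real.pi_ne_zero
  have h := (hasSum_sq_fourierCoeffOn neg_pi_lt_pi hf.ofReal).mul_left (2 * π)
  convert! h using 1
  · funext n
    have := fourierCoeffOn_ofReal (intervalIntegrable_of_memLp_two hf) n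
    erw [this]
    rw [← Complex.normSq_eq_norm_sq, Complex.normSq_apply]
    simp
    field_simp
  · simp
    field_simp
    ring

/-- A square integrable function without oscillating Fourier modes is constant. -/
theorem ae_eq_const_of_integral_cos_sin_eq_zero {f : ℝ → ℝ}
    (hf : MemLp f 2 (volume.restrict (Set.Ioc (-π) π)))
    (hc : ∀ n : ℕ, 0 < n → ∫ x in (-π)..π, f x * Real.cos (n * x) = 0)
    (hs : ∀ n : ℕ, 0 < n → ∫ x in (-π)..π, f x * Real.sin (n * x) = 0) :
    ∃ C : ℝ, f =ᵐ[volume.restrict (Set.Ioc (-π) π)] fun _ => C := by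
  have hpi := Real.pi_ne_zero
  set C : ℝ := 1 / (2 * π) * ∫ x in (-π)..π, f x with hC
  have hfi := intervalIntegrable_of_memLp_two hf
  have hg : MemLp (fun x => f x - C) 2 (volume.restrict (Set.Ioc (-π) π)) :=
    hf.sub (memLp_const C)
  -- Subtracting the mean removes the mode `n = 0` and changes no other mode; negative `n` reduce to
  -- positive ones by parity. Parseval then leaves nothing of `f - C`.
  have hcz : ∀ n : ℤ, ∫ x in (-π)..π, (f x - C) * Real.cos (n * x) = 0 := by
    intro n
    simp_rw [sub_mul]
    rw [intervalIntegral.integral_sub (hfi.mul_continuousOn (by fun_prop))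
      (Continuous.intervalIntegrable (by fun_prop) _ _), intervalIntegral.integral_const_mul]
    rcases eq_or_ne n 0 with rfl | hn
    · simp [hC]
      field_simp
      ring
    · have h1 : ∫ x in (-π)..π, f x * Real.cos (n * x) = 0 := by
        obtain ⟨k, rfl | rfl⟩ := n.eq_nat_or_neg
        · simpa using hc k (by omega)
        · simpa using hc k (by omega)
      have hn' : (n : ℝ) ≠ 0 := by exact_mod_cast hn
      have h2 : ∫ x in (-π)..π, Real.cos (n * x) = 0 := by
        rw [intervalIntegral.integral_comp_mul_left (fun x => Real.cos x) hn', integral_cos]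
        simp [Real.sin_int_mul_pi]
      rw [h1, h2]; ring
  have hsz : ∀ n : ℤ, ∫ x in (-π)..π, (f x - C) * Real.sin (n * x) = 0 := by
    intro n
    simp_rw [sub_mul]
    rw [intervalIntegral.integral_sub (hfi.mul_continuousOn (by fun_prop))
      (Continuous.intervalIntegrable (by fun_prop) _ _), intervalIntegral.integral_const_mul]
    rcases eq_or_ne n 0 with rfl | hn
    · simp
    · have h1 : ∫ x in (-π)..π, f x * Real.sin (n * x) = 0 := by
        obtain ⟨k, rfl | rfl⟩ := n.eq_nat_or_neg
        · simpa using hs k (by omega)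
        · simpa using hs k (by omega)
      have hn' : (n : ℝ) ≠ 0 := by exact_mod_cast hn
      have h2 : ∫ x in (-π)..π, Real.sin (n * x) = 0 := by
        rw [intervalIntegral.integral_comp_mul_left (fun x => Real.sin x) hn', integral_sin]
        simp
      rw [h1, h2]; ring
  have h0 : ∫ x in (-π)..π, (f x - C) ^ 2 = 0 := by
    have h := hasSum_sq_cos_sin hg
    simp_rw [hcz, hsz] at h
    simpa using h.unique (by simp)
  rw [intervalIntegral.integral_of_le neg_pi_lt_pi.le,
    integral_eq_zero_iff_of_nonneg (fun x => sq_nonneg _) hg.integrable_sq] at h0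
  refine ⟨C, ?_⟩
  filter_upwards [h0] with x hx
  have : (f x - C) ^ 2 = 0 := hx
  linarith [pow_eq_zero_iff (two_ne_zero) |>.mp this]

/-! ### Integration by parts against cosines and sines, and Wirtinger's inequality -/

theorem absolutelyContinuousOnInterval_cos (n a b : ℝ) :
    AbsolutelyContinuousOnInterval (fun x => Real.cos (n * x)) a b :=
  ContDiffOn.absolutelyContinuousOnInterval (ContDiff.contDiffOn (by fun_prop))

theorem absolutelyContinuousOnInterval_sin (n a b : ℝ) :
    AbsolutelyContinuousOnInterval (fun x => Real.sin (n * x)) a b :=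
  ContDiffOn.absolutelyContinuousOnInterval (ContDiff.contDiffOn (by fun_prop))

theorem deriv_cos_mul (n x : ℝ) : deriv (fun x => Real.cos (n * x)) x = -n * Real.sin (n * x) := by
  have := ((hasDerivAt_id x).const_mul n).cos.deriv
  simp only [id] at this
  rw [this]; ring

theorem deriv_sin_mul (n x : ℝ) : deriv (fun x => Real.sin (n * x)) x = n * Real.cos (n * x) := by
  have := ((hasDerivAt_id x).const_mul n).sin.deriv
  simp only [id] at this
  rw [this]; ring

theorem integral_deriv_mul_cos {q : ℝ → ℝ} (hq : AbsolutelyContinuousOnInterval q (-π) π)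
    (hper : q π = q (-π)) (n : ℤ) :
    ∫ x in (-π)..π, deriv q x * Real.cos (n * x) = n * ∫ x in (-π)..π, q x * Real.sin (n * x) := by
  have h := hq.integral_mul_deriv_eq_deriv_mul (absolutelyContinuousOnInterval_cos n (-π) π)
  simp_rw [deriv_cos_mul] at h
  have e : ∀ x, q x * (-(n : ℝ) * Real.sin (n * x)) = -n * (q x * Real.sin (n * x)) := by
    intro x; ring
  simp_rw [e, intervalIntegral.integral_const_mul] at h
  rw [hper] at h
  simp at h
  linarith

/-- The boundary terms vanish because `sin (nπ) = 0`, so unlike the cosine case equal endpoint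
values are not needed. -/
theorem integral_deriv_mul_sin {q : ℝ → ℝ} (hq : AbsolutelyContinuousOnInterval q (-π) π)
    (n : ℤ) :
    ∫ x in (-π)..π, deriv q x * Real.sin (n * x) =
      -(n * ∫ x in (-π)..π, q x * Real.cos (n * x)) := by
  have h := hq.integral_mul_deriv_eq_deriv_mul (absolutelyContinuousOnInterval_sin n (-π) π)
  simp_rw [deriv_sin_mul] at h
  have e : ∀ x, q x * ((n : ℝ) * Real.cos (n * x)) = n * (q x * Real.cos (n * x)) := by
    intro x; ring
  simp_rw [e, intervalIntegral.integral_const_mul] at h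
  simp [Real.sin_int_mul_pi] at h
  linarith

/-- Wirtinger's inequality on the circle. -/
theorem integral_sub_mean_sq_le_integral_deriv_sq {q : ℝ → ℝ}
    (hq : AbsolutelyContinuousOnInterval q (-π) π) (hper : q π = q (-π))
    (hq' : MemLp (deriv q) 2 (volume.restrict (Set.Ioc (-π) π))) {m : ℝ}
    (hm : ∫ x in (-π)..π, q x = 2 * π * m) :
    ∫ x in (-π)..π, (q x - m) ^ 2 ≤ ∫ x in (-π)..π, deriv q x ^ 2 := by
  have hac : AbsolutelyContinuousOnInterval (fun x => q x - m) (-π) π :=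
    hq.sub (ContDiffOn.absolutelyContinuousOnInterval (f := fun _ => m) contDiffOn_const)
  have hd : deriv (fun x => q x - m) = deriv q := by
    ext x; simp
  have hcont : ContinuousOn (fun x => q x - m) (Set.Icc (-π) π) := by
    have := hac.continuousOn
    rwa [Set.uIcc_of_le neg_pi_lt_pi.le] at this
  have hL2 : MemLp (fun x => q x - m) 2 (volume.restrict (Set.Ioc (-π) π)) := by
    obtain ⟨D, hD⟩ := hac.exists_bound
    refine MemLp.of_bound ((hcont.mono Set.Ioc_subset_Icc_self).aestronglyMeasurable
      measurableSet_Ioc) D ?_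
    filter_upwards [ae_restrict_mem measurableSet_Ioc] with x hx
    exact hD x (by rw [Set.uIcc_of_le neg_pi_lt_pi.le]; exact Set.Ioc_subset_Icc_self hx)
  -- The comparison is made mode by mode in Parseval's identity: differentiation multiplies the
  -- energy of mode `n` by `n² ≥ 1`, and the mode `n = 0` is absent once the mean is removed.
  refine hasSum_le ?_ (hasSum_sq_cos_sin hL2) (hasSum_sq_cos_sin hq')
  intro n
  have hc := integral_deriv_mul_cos hac (by simp [hper]) n
  have hs := integral_deriv_mul_sin hac n
  rw [hd] at hc hs
  rw [hc, hs]
  have hpi := Real.pi_pos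
  gcongr 1 / (2 * π) * ?_
  rcases eq_or_ne n 0 with rfl | hn
  · have hqi : IntervalIntegrable q volume (-π) π := hq.continuousOn.intervalIntegrable
    have : ∫ x in (-π)..π, (q x - m) = 0 := by
      rw [intervalIntegral.integral_sub hqi (by simp), hm]
      simp
      ring
    simp [this]
  · have hn1 : (1 : ℝ) ≤ (n : ℝ) ^ 2 := by
      have : (1 : ℤ) ≤ n ^ 2 := by have := sq_pos_of_ne_zero hn; omega
      exact_mod_cast this
    set X := ∫ x in (-π)..π, (q x - m) * Real.cos (n * x)
    set Y := ∫ x in (-π)..π, (q x - m) * Real.sin (n * x)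
    nlinarith [mul_nonneg (sub_nonneg.mpr hn1) (add_nonneg (sq_nonneg X) (sq_nonneg Y))]

/-! ### Absolutely continuous functions on `[-π, π]` -/

theorem _root_.AbsolutelyContinuousOnInterval.lipschitzOnWith_comp {f F : ℝ → ℝ} {a b : ℝ}
    {s : Set ℝ} {K : NNReal} (hF : LipschitzOnWith K F s)
    (hf : AbsolutelyContinuousOnInterval f a b) (hs : Set.MapsTo f (Set.uIcc a b) s) :
    AbsolutelyContinuousOnInterval (fun x => F (f x)) a b := by
  rw [absolutelyContinuousOnInterval_iff] at hf ⊢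
  intro ε hε
  -- `K + 1` keeps the divisor positive when `K = 0` and makes the final inequality strict.
  obtain ⟨δ, hδ, h⟩ := hf (ε / (K + 1)) (by positivity)
  refine ⟨δ, hδ, fun E hE hEδ => ?_⟩
  calc ∑ i ∈ Finset.range E.1, dist (F (f (E.2 i).1)) (F (f (E.2 i).2))
      ≤ ∑ i ∈ Finset.range E.1, K * dist (f (E.2 i).1) (f (E.2 i).2) :=
        Finset.sum_le_sum fun i hi =>
          hF.dist_le_mul _ (hs (hE.1 i hi).1) _ (hs (hE.1 i hi).2)
    _ = K * ∑ i ∈ Finset.range E.1, dist (f (E.2 i).1) (f (E.2 i).2) := by rw [Finset.mul_sum]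
    _ ≤ K * (ε / (K + 1)) := by gcongr; exact (h E hE hEδ).le
    _ < (K + 1) * (ε / (K + 1)) := by gcongr; linarith
    _ = ε := by field_simp

theorem _root_.AbsolutelyContinuousOnInterval.congr_uIcc {f g : ℝ → ℝ} {a b : ℝ}
    (hf : AbsolutelyContinuousOnInterval f a b) (h : Set.EqOn f g (Set.uIcc a b)) :
    AbsolutelyContinuousOnInterval g a b := by
  rw [absolutelyContinuousOnInterval_iff] at hf ⊢
  intro ε hε
  obtain ⟨δ, hδ, H⟩ := hf ε hε
  refine ⟨δ, hδ, fun E hE hEδ => ?_⟩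
  rw [Finset.sum_congr rfl fun i hi => by
    rw [← h (hE.1 i hi).1, ← h (hE.1 i hi).2]]
  exact H E hE hEδ

/-- An absolutely continuous function on a compact interval is bounded, so only the restriction of
`F` to some `[-D, D]` matters, and there `F` is Lipschitz. -/
theorem _root_.AbsolutelyContinuousOnInterval.contDiff_comp {f F : ℝ → ℝ} {a b : ℝ}
    (hF : ContDiff ℝ 1 F) (hf : AbsolutelyContinuousOnInterval f a b) :
    AbsolutelyContinuousOnInterval (fun x => F (f x)) a b := by
  obtain ⟨D, hD⟩ := hf.exists_bound
  obtain ⟨K, hK⟩ := (hF.contDiffOn (s := Set.Icc (-D) D)).exists_lipschitzOnWith (by decide)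
    (convex_Icc _ _) isCompact_Icc
  exact hf.lipschitzOnWith_comp hK fun x hx => abs_le.mp (hD x hx)

theorem ae_restrict_Ioc_of_uIcc {P : ℝ → Prop} (h : ∀ᵐ x, x ∈ Set.uIcc (-π) π → P x) :
    ∀ᵐ x ∂(volume.restrict (Set.Ioc (-π) π)), P x := by
  rw [ae_restrict_iff' measurableSet_Ioc]
  filter_upwards [h] with x hx hx'
  exact hx (by rw [Set.uIcc_of_le neg_pi_lt_pi.le]; exact Set.Ioc_subset_Icc_self hx')

theorem integral_congr_of_ae_restrict_Ioc {f g : ℝ → ℝ}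
    (h : f =ᵐ[volume.restrict (Set.Ioc (-π) π)] g) :
    ∫ x in (-π)..π, f x = ∫ x in (-π)..π, g x := by
  rw [intervalIntegral.integral_of_le neg_pi_lt_pi.le,
    intervalIntegral.integral_of_le neg_pi_lt_pi.le]
  exact integral_congr_ae h

theorem absolutelyContinuousOnInterval_const_add_integral {G : ℝ → ℝ}
    (hG : IntervalIntegrable G volume (-π) π) (C : ℝ) :
    AbsolutelyContinuousOnInterval (fun x => C + ∫ t in (-π)..x, G t) (-π) π :=
  (ContDiffOn.absolutelyContinuousOnInterval (f := fun _ => C) contDiffOn_const).fun_add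
    (hG.absolutelyContinuousOnInterval_intervalIntegral (by simp))

theorem ae_hasDerivAt_const_add_integral {G : ℝ → ℝ}
    (hG : IntervalIntegrable G volume (-π) π) (C : ℝ) :
    ∀ᵐ x ∂(volume.restrict (Set.Ioc (-π) π)),
      HasDerivAt (fun x => C + ∫ t in (-π)..x, G t) (G x) x := by
  refine ae_restrict_Ioc_of_uIcc ?_
  filter_upwards [hG.ae_hasDerivAt_integral] with x hx hx'
  exact (hx hx' (-π) (by simp)).const_add C

/-- The du Bois-Reymond lemma on the circle: a weak primitive is a primitive. -/
theorem ae_eq_const_add_integral {g G : ℝ → ℝ}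
    (hg : MemLp g 2 (volume.restrict (Set.Ioc (-π) π)))
    (hG : IntervalIntegrable G volume (-π) π) (hG0 : ∫ x in (-π)..π, G x = 0)
    (hc : ∀ n : ℕ, 0 < n → n * ∫ x in (-π)..π, g x * Real.sin (n * x) =
      ∫ x in (-π)..π, G x * Real.cos (n * x))
    (hs : ∀ n : ℕ, 0 < n → n * ∫ x in (-π)..π, g x * Real.cos (n * x) =
      -∫ x in (-π)..π, G x * Real.sin (n * x)) :
    ∃ C : ℝ, g =ᵐ[volume.restrict (Set.Ioc (-π) π)] fun x => C + ∫ t in (-π)..x, G t := by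
  have hac := absolutelyContinuousOnInterval_const_add_integral hG 0
  have hd := ae_hasDerivAt_const_add_integral hG 0
  set H : ℝ → ℝ := fun x => 0 + ∫ t in (-π)..x, G t with hH
  have hHc : ContinuousOn H (Set.Icc (-π) π) := by
    have := hac.continuousOn
    rwa [Set.uIcc_of_le neg_pi_lt_pi.le] at this
  have hHL2 : MemLp H 2 (volume.restrict (Set.Ioc (-π) π)) := by
    obtain ⟨D, hD⟩ := hac.exists_bound
    refine MemLp.of_bound ((hHc.mono Set.Ioc_subset_Icc_self).aestronglyMeasurable
      measurableSet_Ioc) D ?_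
    filter_upwards [ae_restrict_mem measurableSet_Ioc] with x hx
    exact hD x (by rw [Set.uIcc_of_le neg_pi_lt_pi.le]; exact Set.Ioc_subset_Icc_self hx)
  have hgi := intervalIntegrable_of_memLp_two hg
  have hHi := intervalIntegrable_of_memLp_two hHL2
  have hper : H π = H (-π) := by simp [hH, hG0]
  have e : ∀ w : ℝ → ℝ, ∫ x in (-π)..π, deriv H x * w x = ∫ x in (-π)..π, G x * w x := by
    intro w
    refine integral_congr_of_ae_restrict_Ioc ?_
    filter_upwards [hd] with x hx
    rw [hx.deriv]
  -- The zero mean of `G` gives its primitive `H` equal endpoint values. Integration by parts then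
  -- shows that `H` has the same nonconstant modes as `g`.
  have key : ∃ C : ℝ, (fun x => g x - H x) =ᵐ[volume.restrict (Set.Ioc (-π) π)] fun _ => C := by
    refine ae_eq_const_of_integral_cos_sin_eq_zero (hg.sub hHL2) ?_ ?_
    · intro n hn
      have hn' : (n : ℝ) ≠ 0 := by exact_mod_cast hn.ne'
      have h1 := integral_deriv_mul_sin hac n
      have h2 := hs n hn
      rw [e] at h1
      push_cast at h1
      simp_rw [sub_mul]
      rw [intervalIntegral.integral_sub (hgi.mul_continuousOn (by fun_prop))
        (hHi.mul_continuousOn (by fun_prop))]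
      rw [h1, neg_neg] at h2
      linarith [mul_left_cancel₀ hn' h2]
    · intro n hn
      have hn' : (n : ℝ) ≠ 0 := by exact_mod_cast hn.ne'
      have h1 := integral_deriv_mul_cos hac hper n
      have h2 := hc n hn
      rw [e] at h1
      push_cast at h1
      simp_rw [sub_mul]
      rw [intervalIntegral.integral_sub (hgi.mul_continuousOn (by fun_prop))
        (hHi.mul_continuousOn (by fun_prop))]
      rw [h1] at h2
      linarith [mul_left_cancel₀ hn' h2]
  obtain ⟨C, hC⟩ := key
  refine ⟨C, ?_⟩
  filter_upwards [hC] with x hx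
  have : g x - H x = C := hx
  simp only [hH, zero_add] at this
  linarith

/-! ### Profiles in `H¹` of the circle -/

variable {ψ dψ : ℝ → ℝ}

theorem IsH1Circle.intervalIntegrable (h : IsH1Circle ψ dψ) :
    IntervalIntegrable dψ volume (-π) π :=
  intervalIntegrable_of_memLp_two h.deriv_memLp

theorem IsH1Circle.intervalIntegrable_sq (h : IsH1Circle ψ dψ) :
    IntervalIntegrable (fun x => dψ x ^ 2) volume (-π) π := by
  rw [intervalIntegrable_iff_integrableOn_Ioc_of_le neg_pi_lt_pi.le]
  exact h.deriv_memLp.integrable_sq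

theorem IsH1Circle.apply_pi (h : IsH1Circle ψ dψ) : ψ π = ψ (-π) := by
  have := h.periodic (-π)
  rw [← this]; ring_nf

theorem memLp_two_of_continuous {f : ℝ → ℝ} (hf : Continuous f) :
    MemLp f 2 (volume.restrict (Set.Ioc (-π) π)) := by
  obtain ⟨D, hD⟩ := isCompact_Icc.exists_bound_of_continuousOn (s := Set.Icc (-π) π)
    hf.continuousOn
  refine MemLp.of_bound hf.aestronglyMeasurable D ?_
  filter_upwards [ae_restrict_mem measurableSet_Ioc] with x hx
  exact hD x (Set.Ioc_subset_Icc_self hx)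

theorem memLp_two_continuous_mul {f g : ℝ → ℝ} (hf : Continuous f)
    (hg : MemLp g 2 (volume.restrict (Set.Ioc (-π) π))) :
    MemLp (fun x => f x * g x) 2 (volume.restrict (Set.Ioc (-π) π)) := by
  obtain ⟨D, hD⟩ := isCompact_Icc.exists_bound_of_continuousOn (s := Set.Icc (-π) π)
    hf.continuousOn
  refine hg.of_le_mul (c := D) (hf.aestronglyMeasurable.mul hg.1) ?_
  filter_upwards [ae_restrict_mem measurableSet_Ioc] with x hx
  rw [norm_mul]
  gcongr
  exact hD x (Set.Ioc_subset_Icc_self hx)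

/-- Constants, cosines and sines suffice as test functions for the weak derivative: they are the
hypotheses of `ae_eq_const_add_integral`. Continuity of both sides upgrades the a.e. equality to all
of `[-π, π]`. -/
theorem IsH1Circle.exists_eq_const_add_integral (h : IsH1Circle ψ dψ) :
    ∃ C : ℝ, ∀ x ∈ Set.Icc (-π) π, ψ x = C + ∫ t in (-π)..x, dψ t := by
  have hi := h.intervalIntegrable
  have h0 : ∫ x in (-π)..π, dψ x = 0 := by
    have := h.weak_deriv (fun _ => 1) contDiff_const (fun _ => rfl)
    simpa using this.symm
  have hcosp : ∀ n : ℕ, Function.Periodic (fun x => Real.cos (n * x)) (2 * π) := fun n x => by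
    simp only [mul_add]; exact Real.cos_add_nat_mul_two_pi _ _
  have hsinp : ∀ n : ℕ, Function.Periodic (fun x => Real.sin (n * x)) (2 * π) := fun n x => by
    simp only [mul_add]; exact Real.sin_add_nat_mul_two_pi _ _
  obtain ⟨C, hC⟩ := ae_eq_const_add_integral (memLp_two_of_continuous h.continuous) hi h0
    (fun n _ => by
      have := h.weak_deriv (fun x => Real.cos (n * x)) (by fun_prop) (hcosp n)
      simp_rw [deriv_cos_mul] at this
      have e : ∀ x, ψ x * (-(n : ℝ) * Real.sin (n * x)) = -n * (ψ x * Real.sin (n * x)) := by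
        intro x; ring
      simp_rw [e, intervalIntegral.integral_const_mul] at this
      linarith)
    (fun n _ => by
      have := h.weak_deriv (fun x => Real.sin (n * x)) (by fun_prop) (hsinp n)
      simp_rw [deriv_sin_mul] at this
      have e : ∀ x, ψ x * ((n : ℝ) * Real.cos (n * x)) = n * (ψ x * Real.cos (n * x)) := by
        intro x; ring
      simp_rw [e, intervalIntegral.integral_const_mul] at this
      linarith)
  refine ⟨C, ?_⟩
  have hac := (absolutelyContinuousOnInterval_const_add_integral hi C).continuousOn
  rw [Set.uIcc_of_le neg_pi_lt_pi.le] at hac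
  rw [Measure.restrict_congr_set Ioc_ae_eq_Icc] at hC
  exact Measure.eqOn_Icc_of_ae_eq _ neg_pi_lt_pi.ne hC h.continuous.continuousOn hac

theorem IsH1Circle.absolutelyContinuousOnInterval (h : IsH1Circle ψ dψ) :
    AbsolutelyContinuousOnInterval ψ (-π) π := by
  obtain ⟨C, hC⟩ := h.exists_eq_const_add_integral
  refine (absolutelyContinuousOnInterval_const_add_integral h.intervalIntegrable C).congr_uIcc ?_
  intro x hx
  rw [Set.uIcc_of_le neg_pi_lt_pi.le] at hx
  exact (hC x hx).symm

theorem IsH1Circle.ae_hasDerivAt (h : IsH1Circle ψ dψ) :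
    ∀ᵐ x ∂(volume.restrict (Set.Ioc (-π) π)), HasDerivAt ψ (dψ x) x := by
  obtain ⟨C, hC⟩ := h.exists_eq_const_add_integral
  have := ae_hasDerivAt_const_add_integral h.intervalIntegrable C
  -- The integral formula holds on `[-π, π]` only, hence near `x` only for interior `x`; the
  -- endpoint is a null set.
  rw [← restrict_Ioo_eq_restrict_Ioc] at this ⊢
  filter_upwards [this, ae_restrict_mem measurableSet_Ioo] with x hx hx'
  refine hx.congr_of_eventuallyEq ?_
  filter_upwards [Ioo_mem_nhds hx'.1 hx'.2] with y hy
  exact hC y (Set.Ioo_subset_Icc_self hy)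

/-! ### Weak solutions of the profile equation -/

/-- The Fourier modes of the profile equation
`(2 λ - 1) (ψ'² - λ² ψ²)' = - 2 λ ((2 λ² - 2 λ) ψ ψ' - (ψ ψ')'' / 2)`. -/
structure IsModeSolution (lam : ℝ) (ψ dψ : ℝ → ℝ) : Prop where
  cos_mode : ∀ n : ℕ, 0 < n →
    (2 * lam - 1) * (n * ∫ x in (-π)..π, (dψ x ^ 2 - lam ^ 2 * ψ x ^ 2) * Real.cos (n * x)) =
      (2 * lam ^ 2 - 2 * lam + n ^ 2 / 2) *
        (2 * lam * ∫ x in (-π)..π, ψ x * dψ x * Real.sin (n * x))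
  sin_mode : ∀ n : ℕ, 0 < n →
    (2 * lam - 1) * (n * ∫ x in (-π)..π, (dψ x ^ 2 - lam ^ 2 * ψ x ^ 2) * Real.sin (n * x)) =
      -((2 * lam ^ 2 - 2 * lam + n ^ 2 / 2) *
        (2 * lam * ∫ x in (-π)..π, ψ x * dψ x * Real.cos (n * x)))

theorem IsH1Circle.ae_deriv_comp (h : IsH1Circle ψ dψ) {F F' : ℝ → ℝ}
    (hF : ∀ x, HasDerivAt F (F' x) x) :
    ∀ᵐ x ∂(volume.restrict (Set.Ioc (-π) π)),
      deriv (fun x => F (ψ x)) x = F' (ψ x) * dψ x := by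
  filter_upwards [h.ae_hasDerivAt] with x hx
  exact ((hF (ψ x)).comp x hx).deriv

theorem contDiff_one_of_hasDerivAt {F F' : ℝ → ℝ}
    (hF : ∀ x, HasDerivAt F (F' x) x) (hF' : Continuous F') : ContDiff ℝ 1 F := by
  rw [contDiff_one_iff_deriv]
  refine ⟨fun x => (hF x).differentiableAt, ?_⟩
  rwa [show deriv F = F' from funext fun x => (hF x).deriv]

theorem IsH1Circle.integral_mul_deriv_sin (h : IsH1Circle ψ dψ) (n : ℕ) :
    2 * ∫ x in (-π)..π, ψ x * dψ x * Real.sin (n * x) =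
      -(n * ∫ x in (-π)..π, ψ x ^ 2 * Real.cos (n * x)) := by
  have hac := h.absolutelyContinuousOnInterval.contDiff_comp (F := fun x => x ^ 2) (by fun_prop)
  have h1 := integral_deriv_mul_sin hac n
  push_cast at h1
  rw [← h1, ← intervalIntegral.integral_const_mul]
  refine integral_congr_of_ae_restrict_Ioc ?_
  filter_upwards [h.ae_deriv_comp (F := fun x => x ^ 2) (F' := fun x => 2 * x)
    (fun x => by simpa using hasDerivAt_pow 2 x)] with x hx
  rw [hx]; ring

theorem IsH1Circle.integral_mul_deriv_cos (h : IsH1Circle ψ dψ) (n : ℕ) :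
    2 * ∫ x in (-π)..π, ψ x * dψ x * Real.cos (n * x) =
      n * ∫ x in (-π)..π, ψ x ^ 2 * Real.sin (n * x) := by
  have hac := h.absolutelyContinuousOnInterval.contDiff_comp (F := fun x => x ^ 2) (by fun_prop)
  have h1 := integral_deriv_mul_cos hac (by simp only [h.apply_pi]) n
  push_cast at h1
  rw [← h1, ← intervalIntegral.integral_const_mul]
  refine integral_congr_of_ae_restrict_Ioc ?_
  filter_upwards [h.ae_deriv_comp (F := fun x => x ^ 2) (F' := fun x => 2 * x)
    (fun x => by simpa using hasDerivAt_pow 2 x)] with x hx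
  rw [hx]; ring

theorem integral_cos_nat_mul {n : ℕ} (hn : 0 < n) : ∫ x in (-π)..π, Real.cos (n * x) = 0 := by
  have hn' : (n : ℝ) ≠ 0 := by exact_mod_cast hn.ne'
  rw [intervalIntegral.integral_comp_mul_left (fun x => Real.cos x) hn', integral_cos]
  simp

theorem integral_sin_nat_mul {n : ℕ} (hn : 0 < n) : ∫ x in (-π)..π, Real.sin (n * x) = 0 := by
  have hn' : (n : ℝ) ≠ 0 := by exact_mod_cast hn.ne'
  rw [intervalIntegral.integral_comp_mul_left (fun x => Real.sin x) hn', integral_sin]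
  simp

/-- The profile equation `λ (ψ ψ')' = (2 λ - 1) ψ'² - λ² ψ² - k`, integrated once. -/
theorem IsModeSolution.exists_profile_equation {lam : ℝ} (h : IsH1Circle ψ dψ)
    (hm : IsModeSolution lam ψ dψ) :
    ∃ k C : ℝ, (∫ x in (-π)..π, ((2 * lam - 1) * dψ x ^ 2 - lam ^ 2 * ψ x ^ 2 - k) = 0) ∧
      (fun x => lam * ψ x * dψ x) =ᵐ[volume.restrict (Set.Ioc (-π) π)] fun x =>
        C + ∫ t in (-π)..x, ((2 * lam - 1) * dψ t ^ 2 - lam ^ 2 * ψ t ^ 2 - k) := by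
  have hψ := h.continuous
  have hpi := Real.pi_ne_zero
  have hd2 := h.intervalIntegrable_sq
  have hi1 : IntervalIntegrable (fun x => (2 * lam - 1) * dψ x ^ 2 - lam ^ 2 * ψ x ^ 2)
      volume (-π) π := (hd2.const_mul _).sub (Continuous.intervalIntegrable (by fun_prop) _ _)
  have split : ∀ (a : ℝ) (w : ℝ → ℝ), Continuous w →
      ∫ x in (-π)..π, (a * dψ x ^ 2 - lam ^ 2 * ψ x ^ 2) * w x =
        a * (∫ x in (-π)..π, dψ x ^ 2 * w x) - lam ^ 2 * ∫ x in (-π)..π, ψ x ^ 2 * w x := by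
    intro a w hw
    rw [← intervalIntegral.integral_const_mul, ← intervalIntegral.integral_const_mul,
      ← intervalIntegral.integral_sub ((hd2.mul_continuousOn hw.continuousOn).const_mul _)
      (Continuous.intervalIntegrable (by fun_prop) _ _)]
    congr 1; ext x; ring
  -- The constant `k` is a mean value, so that the right-hand side integrates to zero over the
  -- circle and has a periodic primitive.
  set k : ℝ := 1 / (2 * π) * ∫ x in (-π)..π, ((2 * lam - 1) * dψ x ^ 2 - lam ^ 2 * ψ x ^ 2)
    with hk
  have hG0 : ∫ x in (-π)..π, ((2 * lam - 1) * dψ x ^ 2 - lam ^ 2 * ψ x ^ 2 - k) = 0 := by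
    rw [intervalIntegral.integral_sub hi1 (by simp), intervalIntegral.integral_const, hk]
    simp
    field_simp
    ring
  have splitk : ∀ w : ℝ → ℝ, Continuous w → ∫ x in (-π)..π, w x = 0 →
      ∫ x in (-π)..π, ((2 * lam - 1) * dψ x ^ 2 - lam ^ 2 * ψ x ^ 2 - k) * w x =
        (2 * lam - 1) * (∫ x in (-π)..π, dψ x ^ 2 * w x) -
          lam ^ 2 * ∫ x in (-π)..π, ψ x ^ 2 * w x := by
    intro w hw hw0
    rw [← split _ w hw]
    simp_rw [sub_mul _ k]
    rw [intervalIntegral.integral_sub (hi1.mul_continuousOn hw.continuousOn)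
      (Continuous.intervalIntegrable (by fun_prop) _ _), intervalIntegral.integral_const_mul, hw0]
    ring
  have fac : ∀ w : ℝ → ℝ, ∫ x in (-π)..π, lam * ψ x * dψ x * w x =
      lam * ∫ x in (-π)..π, ψ x * dψ x * w x := by
    intro w
    rw [← intervalIntegral.integral_const_mul]
    congr 1; ext x; ring
  obtain ⟨C, hC⟩ := ae_eq_const_add_integral (g := fun x => lam * ψ x * dψ x)
    (memLp_two_continuous_mul (by fun_prop) h.deriv_memLp) (hi1.sub (by simp)) hG0
    (fun n hn => by
      have hn' : (n : ℝ) ≠ 0 := by exact_mod_cast hn.ne'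
      have h1 := hm.cos_mode n hn
      have h2 := h.integral_mul_deriv_sin n
      have e := split 1 (fun x => Real.cos (n * x)) (by fun_prop)
      simp only [one_mul] at e
      rw [e] at h1
      rw [splitk _ (by fun_prop) (integral_cos_nat_mul hn), fac]
      -- Writing part of the `ψψ'` term through `2ψψ' = (ψ²)'` adds `λ(2λ² - 2λ)` to the coefficient
      -- `-(2λ - 1)λ²` of `ψ²`; the sum is `-λ²`. The remaining `n²` term is the derivative of
      -- `ψψ'`, up to the factor `n` cancelled here.
      refine mul_left_cancel₀ hn' ?_
      set Q := ∫ x in (-π)..π, ψ x ^ 2 * Real.cos (n * x)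
      set S := ∫ x in (-π)..π, ψ x * dψ x * Real.sin (n * x)
      linear_combination -h1 - lam * (2 * lam ^ 2 - 2 * lam) * h2)
    (fun n hn => by
      have hn' : (n : ℝ) ≠ 0 := by exact_mod_cast hn.ne'
      have h1 := hm.sin_mode n hn
      have h2 := h.integral_mul_deriv_cos n
      have e := split 1 (fun x => Real.sin (n * x)) (by fun_prop)
      simp only [one_mul] at e
      rw [e] at h1
      rw [splitk _ (by fun_prop) (integral_sin_nat_mul hn), fac]
      refine mul_left_cancel₀ hn' ?_
      set Q := ∫ x in (-π)..π, ψ x ^ 2 * Real.sin (n * x)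
      set S := ∫ x in (-π)..π, ψ x * dψ x * Real.cos (n * x)
      linear_combination h1 - lam * (2 * lam ^ 2 - 2 * lam) * h2)
  exact ⟨k, C, hG0, hC⟩

/-- The profile equation tested against a function of `ψ`. -/
theorem IsModeSolution.exists_integral_identity {lam : ℝ} (h : IsH1Circle ψ dψ)
    (hm : IsModeSolution lam ψ dψ) :
    ∃ k : ℝ, ∀ F F' : ℝ → ℝ, (∀ x, HasDerivAt F (F' x) x) → Continuous F' →
      ∫ x in (-π)..π, dψ x ^ 2 * (lam * (ψ x * F' (ψ x)) + (2 * lam - 1) * F (ψ x)) =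
        ∫ x in (-π)..π, (lam ^ 2 * ψ x ^ 2 + k) * F (ψ x) := by
  obtain ⟨k, C, hG0, hC⟩ := hm.exists_profile_equation h
  refine ⟨k, fun F F' hF hF' => ?_⟩
  have hψ := h.continuous
  have hd2 := h.intervalIntegrable_sq
  have hFc : Continuous F := continuous_iff_continuousAt.mpr fun x => (hF x).continuousAt
  have hG : IntervalIntegrable (fun x => (2 * lam - 1) * dψ x ^ 2 - lam ^ 2 * ψ x ^ 2 - k)
      volume (-π) π := ((hd2.const_mul _).sub (Continuous.intervalIntegrable (by fun_prop) _ _)).sub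
        (by simp)
  have hφ := h.absolutelyContinuousOnInterval.contDiff_comp (contDiff_one_of_hasDerivAt hF hF')
  have hW := absolutelyContinuousOnInterval_const_add_integral hG C
  have ibp := hW.integral_mul_deriv_eq_deriv_mul hφ
  -- Both factors take equal values at `-π` and `π`, so the boundary terms cancel.
  rw [hG0, h.apply_pi] at ibp
  have e1 : ∫ x in (-π)..π, (C + ∫ t in (-π)..x,
        ((2 * lam - 1) * dψ t ^ 2 - lam ^ 2 * ψ t ^ 2 - k)) * deriv (fun x => F (ψ x)) x =
      ∫ x in (-π)..π, dψ x ^ 2 * (lam * (ψ x * F' (ψ x))) := by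
    refine integral_congr_of_ae_restrict_Ioc ?_
    filter_upwards [hC, h.ae_deriv_comp hF] with x hx hx'
    rw [← hx, hx']; ring
  have e2 : ∫ x in (-π)..π, deriv (fun x => C + ∫ t in (-π)..x,
        ((2 * lam - 1) * dψ t ^ 2 - lam ^ 2 * ψ t ^ 2 - k)) x * F (ψ x) =
      ∫ x in (-π)..π, ((2 * lam - 1) * dψ x ^ 2 - lam ^ 2 * ψ x ^ 2 - k) * F (ψ x) := by
    refine integral_congr_of_ae_restrict_Ioc ?_
    filter_upwards [ae_hasDerivAt_const_add_integral hG C] with x hx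
    rw [hx.deriv]
  rw [e1, e2] at ibp
  simp only [integral_same, add_zero, sub_self, zero_sub] at ibp
  have i1 : IntervalIntegrable (fun x => dψ x ^ 2 * (lam * (ψ x * F' (ψ x)))) volume (-π) π :=
    hd2.mul_continuousOn (Continuous.continuousOn (by fun_prop))
  have i2 : IntervalIntegrable (fun x => dψ x ^ 2 * ((2 * lam - 1) * F (ψ x))) volume (-π) π :=
    hd2.mul_continuousOn (Continuous.continuousOn (by fun_prop))
  have i3 : IntervalIntegrable (fun x => (lam ^ 2 * ψ x ^ 2 + k) * F (ψ x)) volume (-π) π :=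
    Continuous.intervalIntegrable (by fun_prop) _ _
  have e3 : ∫ x in (-π)..π, ((2 * lam - 1) * dψ x ^ 2 - lam ^ 2 * ψ x ^ 2 - k) * F (ψ x) =
      (∫ x in (-π)..π, dψ x ^ 2 * ((2 * lam - 1) * F (ψ x))) -
        ∫ x in (-π)..π, (lam ^ 2 * ψ x ^ 2 + k) * F (ψ x) := by
    rw [← intervalIntegral.integral_sub i2 i3]
    congr 1; ext x; ring
  simp_rw [mul_add (dψ _ ^ 2)]
  rw [intervalIntegral.integral_add i1 i2, ibp, e3]
  ring

/-! ### Rigidity of the profile equation for `0 < λ < 1 / 2` -/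

/-- For `F(s) = |s|^a` the bracket in the integral identity is `(λa + 2λ - 1)|s|^a`. The exponent `a
= 1/λ - 2` makes the coefficient `0`, and `a = 2/λ - 2` makes it `1`. -/
theorem IsModeSolution.exists_energy_relations {lam : ℝ} (hlam : 0 < lam) (hlam' : lam < 1 / 2)
    (h : IsH1Circle ψ dψ) (hm : IsModeSolution lam ψ dψ) :
    ∃ k : ℝ,
      (∫ x in (-π)..π, (lam ^ 2 * ψ x ^ 2 + k) * |ψ x| ^ (1 / lam - 2) ≤ 0) ∧
      ∫ x in (-π)..π, dψ x ^ 2 * |ψ x| ^ (2 / lam - 2) =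
        ∫ x in (-π)..π, (lam ^ 2 * ψ x ^ 2 + k) * |ψ x| ^ (2 / lam - 2) := by
  obtain ⟨k, hk⟩ := hm.exists_integral_identity h
  have hψ := h.continuous
  have hinv : 2 < 1 / lam := by rw [lt_div_iff₀ hlam]; linarith
  refine ⟨k, ?_, ?_⟩
  · set α := 1 / lam - 2 with hα
    have hα0 : 0 < α := by linarith
    have hlα : lam * α = 1 - 2 * lam := by rw [hα]; field_simp
    -- `|s|^α` need not be `C¹` at `0`, as `α` may be at most `1`. With `(s² + ε)^(α/2)` instead,
    -- the bracket is `-(1 - 2λ) ε (s² + ε)^(α/2 - 1) ≤ 0`, and the sign survives the limit `ε →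
    -- 0⁺`.
    have hε : ∀ ε : ℝ, 0 < ε →
        ∫ x in (-π)..π, (lam ^ 2 * ψ x ^ 2 + k) * (ψ x ^ 2 + ε) ^ (α / 2) ≤ 0 := by
      intro ε hε
      have hpos : ∀ x : ℝ, 0 < x ^ 2 + ε := fun x => by positivity
      have hd : ∀ x : ℝ, HasDerivAt (fun x : ℝ => (x ^ 2 + ε) ^ (α / 2))
          (2 * x * (α / 2) * (x ^ 2 + ε) ^ (α / 2 - 1)) x := fun x => by
        have := ((hasDerivAt_pow 2 x).add_const ε).rpow_const (p := α / 2) (Or.inl (hpos x).ne')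
        simpa using this
      rw [← hk _ _ hd (Continuous.mul (by fun_prop)
        (Continuous.rpow_const (by fun_prop) fun x => Or.inl (hpos x).ne'))]
      rw [← neg_nonneg, ← intervalIntegral.integral_neg]
      refine intervalIntegral.integral_nonneg neg_pi_lt_pi.le fun x _ => ?_
      rw [neg_nonneg]
      have e : (ψ x ^ 2 + ε) ^ (α / 2) = (ψ x ^ 2 + ε) ^ (α / 2 - 1) * (ψ x ^ 2 + ε) := by
        rw [← Real.rpow_add_one (hpos _).ne']; ring_nf
      rw [e]
      have hP := (Real.rpow_pos_of_pos (hpos (ψ x)) (α / 2 - 1)).le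
      set P := (ψ x ^ 2 + ε) ^ (α / 2 - 1)
      have : dψ x ^ 2 * (lam * (ψ x * (2 * ψ x * (α / 2) * P)) +
          (2 * lam - 1) * (P * (ψ x ^ 2 + ε))) = -(dψ x ^ 2 * P * ε * (1 - 2 * lam)) := by
        linear_combination dψ x ^ 2 * ψ x ^ 2 * P * hlα
      rw [this]
      have : 0 ≤ 1 - 2 * lam := by linarith
      have := hε.le
      rw [neg_nonpos]
      positivity
    have hcont : Continuous fun ε : ℝ =>
        ∫ x in (-π)..π, (lam ^ 2 * ψ x ^ 2 + k) * (ψ x ^ 2 + ε) ^ (α / 2) := by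
      refine intervalIntegral.continuous_parametric_intervalIntegral_of_continuous' ?_ _ _
      exact Continuous.mul (by fun_prop)
        (Continuous.rpow_const (by fun_prop) fun x => Or.inr (by positivity))
    have h0 : ∀ x, |ψ x| ^ α = (ψ x ^ 2 + 0) ^ (α / 2) := by
      intro x
      rw [add_zero, ← sq_abs, ← Real.rpow_natCast, ← Real.rpow_mul (abs_nonneg _)]
      congr 1; push_cast; ring
    simp_rw [h0]
    refine le_of_tendsto ((hcont.tendsto 0).mono_left (nhdsWithin_le_nhds (s := Set.Ioi 0))) ?_
    filter_upwards [self_mem_nhdsWithin] with ε hε' using hε ε hε'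
  · set β := 2 / lam - 2 with hβ
    have hβ' : β = 2 * (1 / lam) - 2 := by rw [hβ]; ring
    have hβ0 : 2 < β := by linarith
    have hlβ : lam * β = 2 - 2 * lam := by rw [hβ]; field_simp
    -- Since `β > 2`, the function `|s|^β` is already `C¹` and needs no regularization.
    rw [← hk _ _ (fun x => hasDerivAt_abs_rpow x (by linarith : 1 < β))
      (Continuous.mul (Continuous.mul continuous_const
        (Continuous.rpow_const continuous_abs fun x => Or.inr (by linarith))) continuous_id)]
    congr 1; ext x
    have e : |ψ x| ^ β = |ψ x| ^ (β - 2) * ψ x ^ 2 := by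
      rcases eq_or_ne (ψ x) 0 with h0 | h0
      · simp [h0, Real.zero_rpow (by linarith : β ≠ 0)]
      · rw [← sq_abs, ← Real.rpow_natCast, ← Real.rpow_add (abs_pos.mpr h0)]
        congr 1; push_cast; ring
    rw [e]
    linear_combination -(dψ x ^ 2 * |ψ x| ^ (β - 2) * ψ x ^ 2) * hlβ

theorem eq_zero_of_integral_nonpos {f : ℝ → ℝ} (hf : Continuous f) (h0 : ∀ x, 0 ≤ f x)
    (hi : ∫ x in (-π)..π, f x ≤ 0) : ∀ x ∈ Set.Icc (-π) π, f x = 0 := by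
  intro x hx
  by_contra hne
  exact absurd (intervalIntegral.integral_pos neg_pi_lt_pi hf.continuousOn (fun y _ => h0 y)
    ⟨x, hx, lt_of_le_of_ne (h0 x) (Ne.symm hne)⟩) (not_lt.mpr hi)

/-- Positive powers are strictly increasing on `[0, ∞)`, so both factors have the same sign. This is
the strict integrand of Chebyshev's inequality. -/
theorem mul_sub_rpow_pos {a b y z : ℝ} (ha : 0 < a) (hb : 0 < b) (hy : 0 ≤ y) (hz : 0 ≤ z)
    (hne : y ≠ z) : 0 < (y ^ a - z ^ a) * (y ^ b - z ^ b) := by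
  rcases lt_or_gt_of_ne hne with hlt | hlt
  · exact mul_pos_of_neg_of_neg (sub_neg.mpr (Real.rpow_lt_rpow hy hlt ha))
      (sub_neg.mpr (Real.rpow_lt_rpow hy hlt hb))
  · exact mul_pos (sub_pos.mpr (Real.rpow_lt_rpow hz hlt ha))
      (sub_pos.mpr (Real.rpow_lt_rpow hz hlt hb))

/-- Wirtinger's inequality for `|ψ|^(1/λ)` and the two energy relations together force a nonpositive
covariance between `|ψ|^(1/λ)` and `|ψ|^(1/λ - 2)`. Both increase strictly with `|ψ|`, so `|ψ|`
cannot vary. -/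
theorem IsModeSolution.exists_abs_eq {lam : ℝ} (hlam : 0 < lam) (hlam' : lam < 1 / 2)
    (h : IsH1Circle ψ dψ) (hm : IsModeSolution lam ψ dψ) :
    ∃ μ : ℝ, ∀ x ∈ Set.Icc (-π) π, |ψ x| = μ := by
  obtain ⟨k, hA, hB⟩ := hm.exists_energy_relations hlam hlam' h
  have hψ := h.continuous
  have hpi := Real.pi_pos
  have hinv : 2 < 1 / lam := by rw [lt_div_iff₀ hlam]; linarith
  have h2inv : 2 / lam = 2 * (1 / lam) := by ring
  rw [h2inv] at hB
  set γ := 1 / lam with hγ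
  have hγlam : γ * lam = 1 := by rw [hγ]; field_simp
  have crp : ∀ p : ℝ, 0 ≤ p → Continuous fun x => |ψ x| ^ p := fun p hp =>
    Continuous.rpow_const (by fun_prop) fun _ => Or.inr hp
  have c1 := crp γ (by linarith)
  have c2 := crp (γ - 2) (by linarith)
  have c3 := crp (2 * γ - 2) (by linarith)
  -- `ψ` may vanish, so exponents are added only when both are positive; `γ > 2` ensures this in
  -- each use.
  have pw : ∀ (x p r : ℝ), 0 < p → 0 < r → |ψ x| ^ p * |ψ x| ^ r = |ψ x| ^ (p + r) :=
    fun x p r hp hr => (Real.rpow_add_of_nonneg (abs_nonneg _) hp.le hr.le).symm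
  have sqp : ∀ x, ψ x ^ 2 = |ψ x| ^ (2 : ℝ) := fun x => by
    rw [← sq_abs, ← Real.rpow_natCast]; norm_num
  have hq2 : ∀ x, ψ x ^ 2 * |ψ x| ^ (2 * γ - 2) = (|ψ x| ^ γ) ^ 2 := fun x => by
    rw [sqp, pw _ _ _ (by linarith) (by linarith), sq, pw _ _ _ (by linarith) (by linarith)]
    ring_nf
  have hq1 : ∀ x, ψ x ^ 2 * |ψ x| ^ (γ - 2) = |ψ x| ^ γ := fun x => by
    rw [sqp, pw _ _ _ (by linarith) (by linarith)]; ring_nf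
  set m : ℝ := 1 / (2 * π) * ∫ x in (-π)..π, |ψ x| ^ γ with hm_def
  have hmean : ∫ x in (-π)..π, |ψ x| ^ γ = 2 * π * m := by rw [hm_def]; field_simp
  have hm0 : 0 ≤ m := mul_nonneg (by positivity)
    (intervalIntegral.integral_nonneg neg_pi_lt_pi.le fun x _ => by positivity)
  have hA' : lam ^ 2 * (2 * π * m) + k * ∫ x in (-π)..π, |ψ x| ^ (γ - 2) ≤ 0 := by
    rw [← hmean, ← intervalIntegral.integral_const_mul, ← intervalIntegral.integral_const_mul,
      ← intervalIntegral.integral_add (Continuous.intervalIntegrable (by fun_prop) _ _)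
        (Continuous.intervalIntegrable (by fun_prop) _ _)]
    refine le_of_eq_of_le ?_ hA
    congr 1; ext x
    rw [← hq1]; ring
  have hB' : ∫ x in (-π)..π, dψ x ^ 2 * |ψ x| ^ (2 * γ - 2) =
      lam ^ 2 * (∫ x in (-π)..π, (|ψ x| ^ γ) ^ 2) + k * ∫ x in (-π)..π, |ψ x| ^ (2 * γ - 2) := by
    rw [hB, ← intervalIntegral.integral_const_mul, ← intervalIntegral.integral_const_mul,
      ← intervalIntegral.integral_add (Continuous.intervalIntegrable (by fun_prop) _ _)
        (Continuous.intervalIntegrable (by fun_prop) _ _)]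
    congr 1; ext x
    rw [← hq2]; ring
  have hQd : ∀ x : ℝ, HasDerivAt (fun x : ℝ => |x| ^ γ) (γ * |x| ^ (γ - 2) * x) x :=
    fun x => hasDerivAt_abs_rpow x (by linarith)
  have hQc : Continuous fun x : ℝ => γ * |x| ^ (γ - 2) * x :=
    (continuous_const.mul (Continuous.rpow_const continuous_abs fun _ =>
      Or.inr (by linarith))).mul continuous_id
  have hqd := h.ae_deriv_comp hQd
  have hW := integral_sub_mean_sq_le_integral_deriv_sq
    (h.absolutelyContinuousOnInterval.contDiff_comp (contDiff_one_of_hasDerivAt hQd hQc))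
    (by simp only [h.apply_pi])
    ((memLp_congr_ae hqd).mpr (memLp_two_continuous_mul (hQc.comp hψ) h.deriv_memLp)) hmean
  have hd2 : ∫ x in (-π)..π, deriv (fun x => |ψ x| ^ γ) x ^ 2 =
      γ ^ 2 * ∫ x in (-π)..π, dψ x ^ 2 * |ψ x| ^ (2 * γ - 2) := by
    rw [← intervalIntegral.integral_const_mul]
    refine integral_congr_of_ae_restrict_Ioc ?_
    filter_upwards [hqd] with x hx
    have : |ψ x| ^ (2 * γ - 2) = |ψ x| ^ (γ - 2) * |ψ x| ^ (γ - 2) * ψ x ^ 2 := by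
      rw [sqp, pw _ _ _ (by linarith) (by linarith), pw _ _ _ (by linarith) (by linarith)]
      ring_nf
    rw [hx, this]; ring
  have hvar : ∫ x in (-π)..π, (|ψ x| ^ γ - m) ^ 2 =
      (∫ x in (-π)..π, (|ψ x| ^ γ) ^ 2) - 2 * π * m ^ 2 := by
    have e : ∀ x, (|ψ x| ^ γ - m) ^ 2 = (|ψ x| ^ γ) ^ 2 - (2 * m * |ψ x| ^ γ - m ^ 2) :=
      fun x => by ring
    simp_rw [e]
    rw [intervalIntegral.integral_sub (Continuous.intervalIntegrable (by fun_prop) _ _)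
      (Continuous.intervalIntegrable (by fun_prop) _ _), intervalIntegral.integral_sub
      (Continuous.intervalIntegrable (by fun_prop) _ _) (by simp),
      intervalIntegral.integral_const_mul, hmean]
    simp
    ring
  rw [hd2, hB', hvar] at hW
  -- As `λγ = 1`, multiplying by `λ²` gives `∫ q²` the same coefficient on both sides of Wirtinger's
  -- inequality, and it cancels; the sharp constant `1` is essential.
  have hlow : -(lam ^ 2 * (2 * π * m ^ 2)) ≤ k * ∫ x in (-π)..π, |ψ x| ^ (2 * γ - 2) := by
    have h1 := mul_le_mul_of_nonneg_left hW (sq_nonneg lam)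
    have h2 : lam ^ 2 * γ ^ 2 = 1 := by rw [← mul_pow, mul_comm, hγlam, one_pow]
    rw [← mul_assoc, h2] at h1
    linarith
  rcases hm0.eq_or_lt with hmz | hmpos
  · refine ⟨0, fun x hx => ?_⟩
    have := eq_zero_of_integral_nonpos c1 (fun x => by positivity)
      (by rw [hmean, ← hmz, mul_zero]) x hx
    rwa [Real.rpow_eq_zero (abs_nonneg _) (by linarith)] at this
  · have hI : 0 ≤ ∫ x in (-π)..π, |ψ x| ^ (γ - 2) :=
      intervalIntegral.integral_nonneg neg_pi_lt_pi.le fun x _ => by positivity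
    have hk : k < 0 := by
      by_contra hk
      have h1 := mul_nonneg (not_lt.mp hk) hI
      have h2 : 0 < lam ^ 2 * (2 * π * m) := by positivity
      linarith
    -- The reference value is chosen with `μ^γ = m`, the mean of `|ψ|^γ`. In the Chebyshev integrand
    -- the term with the constant factor `μ^(γ-2)` then integrates to zero.
    set μ := m ^ lam with hμ
    have hμ0 : 0 ≤ μ := by positivity
    have hμγ : μ ^ γ = m := by
      rw [hμ, ← Real.rpow_mul hm0, mul_comm, hγlam, Real.rpow_one]
    refine ⟨μ, fun x hx => ?_⟩
    have hcov : ∫ x in (-π)..π, (|ψ x| ^ (γ - 2) - μ ^ (γ - 2)) * (|ψ x| ^ γ - μ ^ γ) ≤ 0 := by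
      have e : ∀ x, (|ψ x| ^ (γ - 2) - μ ^ (γ - 2)) * (|ψ x| ^ γ - μ ^ γ) =
          (|ψ x| ^ (2 * γ - 2) - m * |ψ x| ^ (γ - 2)) - μ ^ (γ - 2) * (|ψ x| ^ γ - m) := by
        intro x
        have : |ψ x| ^ (2 * γ - 2) = |ψ x| ^ (γ - 2) * |ψ x| ^ γ := by
          rw [pw _ _ _ (by linarith) (by linarith)]; ring_nf
        rw [this, hμγ]; ring
      simp_rw [e]
      rw [intervalIntegral.integral_sub (Continuous.intervalIntegrable (by fun_prop) _ _)
        (Continuous.intervalIntegrable (by fun_prop) _ _), intervalIntegral.integral_sub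
        (Continuous.intervalIntegrable (by fun_prop) _ _)
        (Continuous.intervalIntegrable (by fun_prop) _ _),
        intervalIntegral.integral_const_mul, intervalIntegral.integral_const_mul,
        intervalIntegral.integral_sub (Continuous.intervalIntegrable (by fun_prop) _ _) (by simp),
        hmean]
      have h1 := mul_le_mul_of_nonneg_left hA' hm0
      have h2 : 0 ≤ k * ((∫ x in (-π)..π, |ψ x| ^ (2 * γ - 2)) -
          m * ∫ x in (-π)..π, |ψ x| ^ (γ - 2)) := by nlinarith
      have h3 := nonpos_of_mul_nonneg_right h2 hk
      simp
      linarith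
    by_contra hne
    have hp := mul_sub_rpow_pos (a := γ - 2) (b := γ) (by linarith) (by linarith)
      (abs_nonneg (ψ x)) hμ0 hne
    have hz := eq_zero_of_integral_nonpos ((c2.sub continuous_const).mul
      (c1.sub continuous_const)) (fun y => ?_) hcov x hx
    · exact hp.ne' hz
    · rcases eq_or_ne |ψ y| μ with hy | hy
      · simp [hy]
      · exact (mul_sub_rpow_pos (by linarith) (by linarith) (abs_nonneg _) hμ0 hy).le

/-! ### Constant profiles and the classification -/

theorem IsModeSolution.isRotational {lam : ℝ} (hlam : 0 < lam) (hlam' : lam < 1 / 2)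
    (h : IsH1Circle ψ dψ) (hm : IsModeSolution lam ψ dψ) : IsRotational ψ := by
  obtain ⟨μ, hμ⟩ := hm.exists_abs_eq hlam hlam' h
  have hall : ∀ x, |ψ x| = μ := by
    intro x
    obtain ⟨y, hy, hxy⟩ := h.periodic.exists_mem_Ioc (by positivity : 0 < 2 * π) x (-π)
    rw [hxy]
    exact hμ y ⟨hy.1.le, by linarith [hy.2]⟩
  rcases eq_or_ne μ 0 with h0 | h0
  · exact ⟨0, fun x => by simpa [h0] using hall x⟩
  -- A continuous function with `ψ² = μ² ≠ 0` cannot change sign on the connected line.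
  · rcases isPreconnected_univ.eq_or_eq_neg_of_sq_eq h.continuous.continuousOn
      (continuousOn_const (c := μ)) (fun x _ => by simp [← hall x]) (fun _ => h0) with hc | hc
    · exact ⟨μ, fun x => hc (Set.mem_univ x)⟩
    · exact ⟨-μ, fun x => hc (Set.mem_univ x)⟩

theorem IsRotational.classification {lam : ℝ} (h : IsRotational ψ) :
    IsTrivial lam ψ ∧ ((∀ θ, ψ θ = 0) ∨ IsElliptic ψ) ∧ ¬ IsHyperbolic lam ψ ∧
      ¬ IsParabolic ψ ∧ (IsElliptic ψ → IsRotational ψ) := by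
  obtain ⟨c, hc⟩ := h
  refine ⟨Or.inl ⟨c, hc⟩, ?_, ?_, ?_, fun _ => ⟨c, hc⟩⟩
  · rcases eq_or_ne c 0 with rfl | h0
    · exact Or.inl hc
    · exact Or.inr fun θ => by rwa [hc]
  · rintro ⟨⟨θ, -, -, -, -, hz, -⟩, hns⟩
    -- The zero profile is itself the parallel shear flow with `A = B = 0`.
    exact hns ⟨0, 0, 0, fun x => by rw [hc, ← hc θ, hz]; simp⟩
  · rintro ⟨θ, ⟨-, hz⟩, huniq⟩
    have hpi := Real.pi_pos
    have h1 := huniq 0 ⟨⟨by linarith, hpi.le⟩, by rw [hc, ← hc θ, hz]⟩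
    have h2 := huniq π ⟨⟨by linarith, le_rfl⟩, by rw [hc, ← hc θ, hz]⟩
    exact hpi.ne (h1.trans h2.symm)

open ComplexConjugate

/-! ### Solenoidal test fields with a single angular mode -/

theorem contDiff_normSq {n : WithTop ℕ∞} : ContDiff ℝ n Complex.normSq := by
  have : (Complex.normSq : ℂ → ℝ) = fun z => ‖z‖ ^ 2 :=
    funext fun z => Complex.normSq_eq_norm_sq z
  rw [this]
  exact contDiff_norm_sq ℝ

theorem isCompact_normSq_preimage_Icc (a b : ℝ) :
    IsCompact {z : ℂ | Complex.normSq z ∈ Set.Icc a b} := by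
  refine Metric.isCompact_of_isClosed_isBounded
    (isClosed_Icc.preimage (contDiff_normSq (n := 0)).continuous) ?_
  refine (Metric.isBounded_closedBall (x := (0 : ℂ)) (r := b + 1)).subset fun z hz => ?_
  have h2 : ‖z‖ ^ 2 ≤ b := Complex.normSq_eq_norm_sq z ▸ hz.2
  rw [mem_closedBall_zero_iff]
  nlinarith [norm_nonneg z, sq_nonneg (‖z‖ - 1)]

/-- The field `∇^⊥ η` for `η = Re (c * h (|z|²) * z ^ (m + 1))`; here `h₁ = h'`. -/
def modeField (h h₁ : ℝ → ℝ) (m : ℕ) (c z : ℂ) : ℂ :=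
  Complex.I * (c * (h₁ (Complex.normSq z) : ℂ) * z ^ (m + 2) +
    conj c * ((Complex.normSq z * h₁ (Complex.normSq z) + (m + 1) * h (Complex.normSq z) : ℝ) : ℂ) *
      conj z ^ m)

theorem contDiff_modeField {h h₁ : ℝ → ℝ} (hh : ContDiff ℝ ∞ h) (hh₁ : ContDiff ℝ ∞ h₁) (m : ℕ)
    (c : ℂ) : ContDiff ℝ ∞ (modeField h h₁ m c) := by
  have hN : ContDiff ℝ ∞ Complex.normSq := contDiff_normSq
  have hconj : ContDiff ℝ ∞ (fun z : ℂ => conj z) := Complex.conjCLE.contDiff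
  have hof : ContDiff ℝ ∞ (fun x : ℝ => (x : ℂ)) := Complex.ofRealCLM.contDiff
  unfold modeField
  refine contDiff_const.mul (((contDiff_const.mul (hof.comp (hh₁.comp hN))).mul
    (contDiff_id.pow _)).add ((contDiff_const.mul (hof.comp ?_)).mul (hconj.pow _)))
  exact (hN.mul (hh₁.comp hN)).add (contDiff_const.mul (hh.comp hN))

theorem modeField_eq_zero {h h₁ : ℝ → ℝ} {m : ℕ} {c z : ℂ} (h0 : h (Complex.normSq z) = 0)
    (h1 : h₁ (Complex.normSq z) = 0) : modeField h h₁ m c z = 0 := by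
  simp [modeField, h0, h1]

/-- The derivative is sorted as `a w + b w̄`, that is, into `∂_z` and `∂_z̄` parts. The coefficient
`a` is `i` times a real number, which is solenoidality; hence only `b` contributes to the quadratic
form `⟨Dv w, w⟩ = Re (b w̄²)`. The truncated exponent `m - 1` is harmless at `m = 0` because its
term carries the factor `m`. -/
theorem hasDerivAt_modeField_line {h h₁ h₂ : ℝ → ℝ} (hh : ∀ x, HasDerivAt h (h₁ x) x)
    (hh₁ : ∀ x, HasDerivAt h₁ (h₂ x) x) (m : ℕ) (c z w : ℂ) :
    HasDerivAt (fun t : ℝ => modeField h h₁ m c (z + t • w))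
      (Complex.I * ((Complex.normSq z * h₂ (Complex.normSq z) +
          (m + 2) * h₁ (Complex.normSq z) : ℝ) : ℂ) *
          (c * z ^ (m + 1) + conj (c * z ^ (m + 1))) * w +
        Complex.I * (c * h₂ (Complex.normSq z) * z ^ (m + 3) +
          conj c * (((Complex.normSq z * h₂ (Complex.normSq z) +
            (m + 2) * h₁ (Complex.normSq z) : ℝ) : ℂ) * z * conj z ^ m +
          m * ((Complex.normSq z * h₁ (Complex.normSq z) + (m + 1) * h (Complex.normSq z) : ℝ) : ℂ) *
            conj z ^ (m - 1))) * conj w) 0 := by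
  set ρ := Complex.normSq z with hρ
  have hz : HasDerivAt (fun t : ℝ => z + t • w) w 0 := by
    simpa using ((hasDerivAt_id (0 : ℝ)).smul_const w).const_add z
  have hzc : HasDerivAt (fun t : ℝ => conj (z + t • w)) (conj w) 0 :=
    Complex.conjCLE.hasFDerivAt.comp_hasDerivAt (0 : ℝ) hz
  have hN : HasDerivAt (fun t : ℝ => Complex.normSq (z + t • w)) (2 * (z * conj w).re) 0 := by
    have e : (fun t : ℝ => Complex.normSq (z + t • w)) =
        fun t : ℝ => (z.re + t * w.re) ^ 2 + (z.im + t * w.im) ^ 2 := by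
      funext t; simp [Complex.normSq_apply, sq]
    rw [e]
    have h1 := ((((hasDerivAt_id (0 : ℝ)).mul_const w.re).const_add z.re).pow 2).add
      ((((hasDerivAt_id (0 : ℝ)).mul_const w.im).const_add z.im).pow 2)
    refine h1.congr_deriv ?_
    simp
    ring
  have hN0 : Complex.normSq (z + (0 : ℝ) • w) = ρ := by simp [hρ]
  have comp : ∀ {f f' : ℝ → ℝ}, (∀ x, HasDerivAt f (f' x) x) →
      HasDerivAt (fun t : ℝ => f (Complex.normSq (z + t • w)))
        (f' ρ * (2 * (z * conj w).re)) 0 := fun {f f'} hf => by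
    have := (hf (Complex.normSq (z + (0 : ℝ) • w))).comp (0 : ℝ) hN
    rwa [hN0] at this
  have hA := (comp hh₁).ofReal_comp
  have hB := ((hN.mul (comp hh₁)).add ((comp hh).const_mul ((m : ℝ) + 1))).ofReal_comp
  have H := (((hA.const_mul c).mul (hz.pow (m + 2))).add
    ((hB.const_mul (conj c)).mul (hzc.pow m))).const_mul Complex.I
  refine (H.congr_deriv ?_).congr_of_eventuallyEq ?_
  · have hre : ((2 * (z * conj w).re : ℝ) : ℂ) = z * conj w + conj z * w := by
      have := Complex.add_conj (z * conj w)
      rw [map_mul, Complex.conj_conj] at this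
      rw [this]
    have hρc : (ρ : ℂ) = z * conj z := by rw [hρ, Complex.mul_conj]
    simp only [Pi.pow_apply, Pi.mul_apply, Pi.add_apply, zero_smul, add_zero, map_mul, map_pow, Complex.ofReal_add,
      Complex.ofReal_mul, Complex.ofReal_natCast, Complex.ofReal_one, ← hρ]
    push_cast at hre ⊢
    rw [hre, hρc]
    ring
  · exact Filter.Eventually.of_forall fun t => by
      simp [modeField]

theorem fderiv_modeField {h h₁ h₂ : ℝ → ℝ} (hs : ContDiff ℝ ∞ h) (hs₁ : ContDiff ℝ ∞ h₁)
    (hh : ∀ x, HasDerivAt h (h₁ x) x) (hh₁ : ∀ x, HasDerivAt h₁ (h₂ x) x) (m : ℕ) (c z w : ℂ) :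
    fderiv ℝ (modeField h h₁ m c) z w =
      Complex.I * ((Complex.normSq z * h₂ (Complex.normSq z) +
          (m + 2) * h₁ (Complex.normSq z) : ℝ) : ℂ) *
          (c * z ^ (m + 1) + conj (c * z ^ (m + 1))) * w +
        Complex.I * (c * h₂ (Complex.normSq z) * z ^ (m + 3) +
          conj c * (((Complex.normSq z * h₂ (Complex.normSq z) +
            (m + 2) * h₁ (Complex.normSq z) : ℝ) : ℂ) * z * conj z ^ m +
          m * ((Complex.normSq z * h₁ (Complex.normSq z) + (m + 1) * h (Complex.normSq z) : ℝ) : ℂ) *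
            conj z ^ (m - 1))) * conj w := by
  have hd : DifferentiableAt ℝ (modeField h h₁ m c) z :=
    ((contDiff_modeField hs hs₁ m c).differentiable (by simp)).differentiableAt
  rw [← hd.lineDeriv_eq_fderiv]
  exact (hasDerivAt_modeField_line hh hh₁ m c z w).deriv

/-- `modeField` as a test field, when `h` is supported in `[1, 2]`. -/
def modeTestField (h h₁ : ℝ → ℝ) (hs : ContDiff ℝ ∞ h) (hs₁ : ContDiff ℝ ∞ h₁)
    (h0 : ∀ x ∉ Set.Icc (1 : ℝ) 2, h x = 0) (h10 : ∀ x ∉ Set.Icc (1 : ℝ) 2, h₁ x = 0)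
    (m : ℕ) (c : ℂ) : 𝓓(puncturedPlane, ℂ) where
  toFun := modeField h h₁ m c
  contDiff' := contDiff_modeField hs hs₁ m c
  hasCompactSupport' := HasCompactSupport.intro (isCompact_normSq_preimage_Icc 1 2)
    fun z hz => modeField_eq_zero (h0 _ hz) (h10 _ hz)
  tsupport_subset' := by
    have hK : tsupport (modeField h h₁ m c) ⊆ {z : ℂ | Complex.normSq z ∈ Set.Icc (1 : ℝ) 2} := by
      refine closure_minimal (fun z hz => ?_) (isCompact_normSq_preimage_Icc 1 2).isClosed
      by_contra hz'
      exact hz (modeField_eq_zero (h0 _ hz') (h10 _ hz'))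
    refine hK.trans fun z hz => ?_
    rintro rfl
    have : (1 : ℝ) ≤ Complex.normSq 0 := hz.1
    norm_num at this

theorem divergence_modeTestField {h h₁ h₂ : ℝ → ℝ} (hs : ContDiff ℝ ∞ h) (hs₁ : ContDiff ℝ ∞ h₁)
    (h0 : ∀ x ∉ Set.Icc (1 : ℝ) 2, h x = 0) (h10 : ∀ x ∉ Set.Icc (1 : ℝ) 2, h₁ x = 0)
    (hh : ∀ x, HasDerivAt h (h₁ x) x) (hh₁ : ∀ x, HasDerivAt h₁ (h₂ x) x) (m : ℕ) (c : ℂ) :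
    divergence (modeTestField h h₁ hs hs₁ h0 h10 m c) = 0 := by
  ext z
  rw [divergence_apply]
  change (fderiv ℝ (modeField h h₁ m c) z 1).re + (fderiv ℝ (modeField h h₁ m c) z Complex.I).im = 0
  rw [fderiv_modeField hs hs₁ hh hh₁, fderiv_modeField hs hs₁ hh hh₁, Complex.add_conj]
  set β := Complex.I * (c * h₂ (Complex.normSq z) * z ^ (m + 3) +
          conj c * (((Complex.normSq z * h₂ (Complex.normSq z) +
            (m + 2) * h₁ (Complex.normSq z) : ℝ) : ℂ) * z * conj z ^ m +
          m * ((Complex.normSq z * h₁ (Complex.normSq z) + (m + 1) * h (Complex.normSq z) : ℝ) : ℂ) *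
            conj z ^ (m - 1)))
  set a : ℝ := Complex.normSq z * h₂ (Complex.normSq z) + (m + 2) * h₁ (Complex.normSq z)
  set b : ℝ := 2 * (c * z ^ (m + 1)).re
  simp

theorem inner_fderiv_modeField {h h₁ h₂ : ℝ → ℝ} (hs : ContDiff ℝ ∞ h) (hs₁ : ContDiff ℝ ∞ h₁)
    (hh : ∀ x, HasDerivAt h (h₁ x) x) (hh₁ : ∀ x, HasDerivAt h₁ (h₂ x) x) (m : ℕ) (c z w : ℂ) :
    inner ℝ (fderiv ℝ (modeField h h₁ m c) z w) w =
      (Complex.I * (c * h₂ (Complex.normSq z) * z ^ (m + 3) +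
          conj c * (((Complex.normSq z * h₂ (Complex.normSq z) +
            (m + 2) * h₁ (Complex.normSq z) : ℝ) : ℂ) * z * conj z ^ m +
          m * ((Complex.normSq z * h₁ (Complex.normSq z) + (m + 1) * h (Complex.normSq z) : ℝ) : ℂ) *
            conj z ^ (m - 1))) * conj w ^ 2).re := by
  rw [fderiv_modeField hs hs₁ hh hh₁, Complex.add_conj]
  set β := Complex.I * (c * h₂ (Complex.normSq z) * z ^ (m + 3) +
          conj c * (((Complex.normSq z * h₂ (Complex.normSq z) +
            (m + 2) * h₁ (Complex.normSq z) : ℝ) : ℂ) * z * conj z ^ m +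
          m * ((Complex.normSq z * h₁ (Complex.normSq z) + (m + 1) * h (Complex.normSq z) : ℝ) : ℂ) *
            conj z ^ (m - 1)))
  set a : ℝ := Complex.normSq z * h₂ (Complex.normSq z) + (m + 2) * h₁ (Complex.normSq z)
  set b : ℝ := 2 * (c * z ^ (m + 1)).re
  rw [Complex.inner]
  simp [sq]
  ring

/-! ### Polar coordinates -/

/-- The radial factor of `h''(|z|²)` against the velocity. -/
def radialX (h₂ : ℝ → ℝ) (m : ℕ) (r : ℝ) : ℝ := h₂ (r ^ 2) * r ^ (m + 3)

/-- The radial factor of the conjugate mode. -/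
def radialY (h h₁ h₂ : ℝ → ℝ) (m : ℕ) (r : ℝ) : ℝ :=
  (r ^ 2 * h₂ (r ^ 2) + (m + 2) * h₁ (r ^ 2)) * r ^ (m + 1) +
    m * (r ^ 2 * h₁ (r ^ 2) + (m + 1) * h (r ^ 2)) * r ^ (m - 1)

theorem homVelocity_polar (lam : ℝ) (ψ dψ : ℝ → ℝ) {r θ : ℝ} (hr : 0 < r)
    (hθ : θ ∈ Set.Ioc (-π) π) :
    homVelocity lam ψ dψ (r * (Real.cos θ + Real.sin θ * Complex.I)) =
      ((r ^ (lam - 1) : ℝ) : ℂ) * ((Real.cos θ + Real.sin θ * Complex.I) *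
        (-dψ θ + lam * ψ θ * Complex.I)) := by
  have harg : Complex.arg (r * (Real.cos θ + Real.sin θ * Complex.I)) = θ := by
    push_cast
    exact Complex.arg_mul_cos_add_sin_mul_I hr hθ
  have hnorm : ‖(r : ℂ) * (Real.cos θ + Real.sin θ * Complex.I)‖ = r := by
    have := Complex.norm_polarCoord_symm (r, θ)
    rwa [Complex.polarCoord_symm_apply, abs_of_pos hr] at this
  rw [homVelocity, harg, hnorm, angularVec, radialVec]
  generalize Real.cos θ = C
  generalize Real.sin θ = S
  apply Complex.ext <;> simp <;> ring_nf <;> simp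

/-- On the unit circle `conj E = E⁻¹`, so multiplication by `conj E ^ 2` brings both terms to the
single frequency `m + 1`, as `E ^ (m + 1)` and its conjugate. The square `(d + ie)²` supplies `d² -
e²` and `2ed`. -/
theorem mode_mul_conj_sq (m : ℕ) (r : ℝ) {E : ℂ} (hE : E * conj E = 1)
    (c : ℂ) (x a b s d e : ℝ) :
    (Complex.I * (c * x * (r * E) ^ (m + 3) + conj c * (a * (r * E) * conj (r * E) ^ m +
      m * b * conj (r * E) ^ (m - 1))) * conj (s * (E * (-d + e * Complex.I))) ^ 2).re =
    -(s ^ 2 * ((x * r ^ (m + 3) - (a * r ^ (m + 1) + m * b * r ^ (m - 1))) *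
        ((d ^ 2 - e ^ 2) * (c * E ^ (m + 1)).im) +
      (x * r ^ (m + 3) + (a * r ^ (m + 1) + m * b * r ^ (m - 1))) *
        (2 * e * d * (c * E ^ (m + 1)).re))) := by
  have h1 : (m : ℂ) * b * conj (r * E) ^ (m - 1) * conj E ^ 2 =
      m * b * r ^ (m - 1) * conj E ^ (m + 1) := by
    rcases m with _ | k
    · simp
    · simp only [map_mul, Complex.conj_ofReal, Nat.add_sub_cancel]; ring
  have h2 : Complex.I * (c * x * (r * E) ^ (m + 3) + conj c * (a * (r * E) * conj (r * E) ^ m +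
      m * b * conj (r * E) ^ (m - 1))) * conj (s * (E * (-d + e * Complex.I))) ^ 2 =
      ((s ^ 2 : ℝ) : ℂ) * (Complex.I * (((x * r ^ (m + 3) : ℝ) : ℂ) * (c * E ^ (m + 1)) +
        ((a * r ^ (m + 1) + m * b * r ^ (m - 1) : ℝ) : ℂ) * conj (c * E ^ (m + 1))) *
        (((d ^ 2 - e ^ 2 : ℝ) : ℂ) + ((2 * e * d : ℝ) : ℂ) * Complex.I)) := by
    have hI : Complex.I ^ 2 = -1 := Complex.I_sq
    simp only [map_mul, map_add, map_neg, map_pow, Complex.conj_ofReal, Complex.conj_I] at h1 ⊢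
    generalize conj E = Ec at *
    generalize conj c = cc at *
    push_cast
    linear_combination
      Complex.I * s ^ 2 * (d + e * Complex.I) ^ 2 * (c * x * r ^ (m + 3) * E ^ (m + 1) *
        (E * Ec + 1) * hE + cc * a * r ^ (m + 1) * Ec ^ (m + 1) * hE + cc * h1) +
      Complex.I * s ^ 2 * e ^ 2 * (c * x * r ^ (m + 3) * E ^ (m + 1) +
        cc * (a * r ^ (m + 1) + m * b * r ^ (m - 1)) * Ec ^ (m + 1)) * hI
  rw [h2, Complex.re_ofReal_mul]
  set w := c * E ^ (m + 1)
  simp only [Complex.mul_re, Complex.mul_im, Complex.add_re, Complex.add_im, Complex.I_re,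
    Complex.I_im, Complex.ofReal_re, Complex.ofReal_im, Complex.conj_re, Complex.conj_im]
  ring

/-! ### Radial integrals -/

theorem exists_radial_cutoff : ∃ h h₁ h₂ : ℝ → ℝ, ContDiff ℝ ∞ h ∧ ContDiff ℝ ∞ h₁ ∧
    Continuous h₂ ∧ (∀ x, HasDerivAt h (h₁ x) x) ∧ (∀ x, HasDerivAt h₁ (h₂ x) x) ∧
    (∀ x, 0 ≤ h x) ∧ 0 < h (3 / 2) ∧ (∀ x ∉ Set.Icc (1 : ℝ) 2, h x = 0) ∧
    (∀ x ∉ Set.Icc (1 : ℝ) 2, h₁ x = 0) ∧ ∀ x ∉ Set.Icc (1 : ℝ) 2, h₂ x = 0 := by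
  -- Centre `3/2` and outer radius `1/2` give the support `[1, 2]` in the variable `|z|²`.
  let f : ContDiffBump (3 / 2 : ℝ) := ⟨1 / 4, 1 / 2, by norm_num, by norm_num⟩
  have hts : tsupport f = Set.Icc (1 : ℝ) 2 := by
    rw [f.tsupport_eq, Real.closedBall_eq_Icc]
    norm_num [f]
  have hf : ContDiff ℝ ∞ f := f.contDiff
  have hf1 : ContDiff ℝ ∞ (deriv f) := hf.deriv'
  have hf2 : ContDiff ℝ ∞ (deriv (deriv f)) := hf1.deriv'
  have h1s : tsupport (deriv f) ⊆ tsupport f := closure_minimal support_deriv_subset isClosed_closure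
  have h2s : tsupport (deriv (deriv f)) ⊆ tsupport f :=
    (closure_minimal support_deriv_subset isClosed_closure).trans h1s
  refine ⟨f, deriv f, deriv (deriv f), hf, hf1, hf2.continuous,
    fun x => ((hf.differentiable (by simp)) x).hasDerivAt,
    fun x => ((hf1.differentiable (by simp)) x).hasDerivAt, fun x => f.nonneg, ?_,
    fun x hx => image_eq_zero_of_notMem_tsupport (hts ▸ hx),
    fun x hx => image_eq_zero_of_notMem_tsupport fun h => hx (hts ▸ h1s h),
    fun x hx => image_eq_zero_of_notMem_tsupport fun h => hx (hts ▸ h2s h)⟩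
  exact f.pos_of_mem_ball (Metric.mem_ball_self f.rOut_pos)

theorem sq_notMem_Icc {r : ℝ} (hr : 0 < r) (hr' : r ∉ Set.Ioc (1 / 2 : ℝ) 2) :
    r ^ 2 ∉ Set.Icc (1 : ℝ) 2 := by
  rintro ⟨h1, h2⟩
  exact hr' ⟨by nlinarith, by nlinarith⟩

theorem setIntegral_Ioi_eq_intervalIntegral {f : ℝ → ℝ}
    (hf : ∀ r, 0 < r → r ∉ Set.Ioc (1 / 2 : ℝ) 2 → f r = 0) :
    ∫ r in Set.Ioi 0, f r = ∫ r in (1 / 2)..2, f r := by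
  rw [intervalIntegral.integral_of_le (by norm_num)]
  exact setIntegral_eq_of_subset_of_forall_sdiff_eq_zero measurableSet_Ioi
    (fun r hr => lt_trans (by norm_num) hr.1) (fun r hr => hf r hr.1 hr.2)

theorem integrableOn_Ioi_of_support {f : ℝ → ℝ}
    (hf : ∀ r, 0 < r → r ∉ Set.Ioc (1 / 2 : ℝ) 2 → f r = 0)
    (hc : ContinuousOn f (Set.Icc (1 / 2) 2)) : IntegrableOn f (Set.Ioi 0) :=
  (hc.integrableOn_Icc.mono_set Set.Ioc_subset_Icc_self).of_forall_sdiff_eq_zero measurableSet_Ioi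
    (fun r hr => hf r hr.1 hr.2)

section Radial

variable {h h₁ h₂ : ℝ → ℝ} (lam : ℝ) (m : ℕ)

theorem hasDerivAt_comp_sq_mul_rpow {f f' : ℝ → ℝ} (hf : ∀ x, HasDerivAt f (f' x) x) (p : ℝ) {r : ℝ}
    (hr : 0 < r) : HasDerivAt (fun r : ℝ => f (r ^ 2) * r ^ p)
      (2 * f' (r ^ 2) * (r ^ (p - 2) * r ^ 3) + p * f (r ^ 2) * (r ^ (p - 2) * r)) r := by
  have h1 : HasDerivAt (fun r : ℝ => f (r ^ 2)) (f' (r ^ 2) * (2 * r)) r := by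
    exact ((hf (r ^ 2)).comp r (hasDerivAt_pow 2 r)).congr_deriv (by simp)
  refine (h1.mul (Real.hasDerivAt_rpow_const (p := p) (Or.inl hr.ne'))).congr_deriv ?_
  have e1 : r ^ p = r ^ (p - 2) * r ^ 2 := by
    rw [← Real.rpow_natCast, ← Real.rpow_add hr]; congr 1; push_cast; ring
  have e2 : r ^ (p - 1) = r ^ (p - 2) * r := by
    rw [← Real.rpow_add_one hr.ne']; ring_nf
  rw [e1, e2]; ring

/-- Integration by parts in the form of an explicit antiderivative `Φ` of the difference, vanishing
at both ends. It reduces each radial integral to a multiple of the weight `w`. -/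
theorem integral_eq_of_hasDerivAt_add {f Φ w : ℝ → ℝ} (κ : ℝ)
    (hΦ : ∀ r, 0 < r → HasDerivAt Φ (f r - κ * w r) r) (h1 : Φ (1 / 2) = 0) (h2 : Φ 2 = 0)
    (hf : ContinuousOn f (Set.Icc (1 / 2) 2)) (hw : ContinuousOn w (Set.Icc (1 / 2) 2)) :
    ∫ r in (1 / 2)..2, f r = κ * ∫ r in (1 / 2)..2, w r := by
  have hu : Set.uIcc (1 / 2 : ℝ) 2 = Set.Icc (1 / 2) 2 := Set.uIcc_of_le (by norm_num)
  have i1 : IntervalIntegrable f volume (1 / 2) 2 := (hu ▸ hf).intervalIntegrable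
  have i2 : IntervalIntegrable (fun r => κ * w r) volume (1 / 2) 2 :=
    ((hu ▸ hw).intervalIntegrable).const_mul κ
  have := intervalIntegral.integral_eq_sub_of_hasDerivAt
    (fun r hr => hΦ r (lt_of_lt_of_le (by norm_num) (hu ▸ hr : r ∈ Set.Icc (1 / 2 : ℝ) 2).1))
    (i1.sub i2)
  rw [intervalIntegral.integral_sub i1 i2, intervalIntegral.integral_const_mul, h1, h2] at this
  linarith

theorem rpow_mul_pow_relations {r : ℝ} (hr : 0 < r) :
    r * (r ^ (lam - 1)) ^ 2 * r ^ (m + 3) = r ^ (2 * lam + m - 2) * r ^ 4 ∧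
    r * (r ^ (lam - 1)) ^ 2 * r ^ (m + 1) = r ^ (2 * lam + m - 2) * r ^ 2 ∧
    r * (r ^ (lam - 1)) ^ 2 * (m * r ^ (m - 1)) = m * r ^ (2 * lam + m - 2) := by
  have e0 : r * (r ^ (lam - 1)) ^ 2 = r ^ (2 * lam - 1) := by
    rw [sq, ← Real.rpow_add hr, mul_comm, ← Real.rpow_add_one hr.ne']; ring_nf
  have e : r ^ (2 * lam + m - 2) * r = r ^ (2 * lam - 1) * r ^ m := by
    rw [← Real.rpow_add_one hr.ne', ← Real.rpow_natCast, ← Real.rpow_add hr]; ring_nf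
  rw [e0]
  refine ⟨by linear_combination -(r ^ 3) * e, by linear_combination -r * e, ?_⟩
  rcases m with _ | k
  · simp
  · refine mul_right_cancel₀ hr.ne' ?_
    rw [Nat.add_sub_cancel]
    linear_combination -((k + 1 : ℕ) : ℝ) * e

theorem radial_diff_eq {r : ℝ} (hr : 0 < r) :
    r * (r ^ (lam - 1)) ^ 2 * (radialX h₂ m r - radialY h h₁ h₂ m r) =
      r ^ (2 * lam + m - 2) * (-(2 * (m + 1) * h₁ (r ^ 2) * r ^ 2) - m * (m + 1) * h (r ^ 2)) := by
  obtain ⟨e1, e2, e3⟩ := rpow_mul_pow_relations lam m hr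
  rw [radialX, radialY]
  linear_combination h₂ (r ^ 2) * e1 - (r ^ 2 * h₂ (r ^ 2) + (m + 2) * h₁ (r ^ 2)) * e2 -
    (r ^ 2 * h₁ (r ^ 2) + (m + 1) * h (r ^ 2)) * e3

theorem radial_sum_eq {r : ℝ} (hr : 0 < r) :
    r * (r ^ (lam - 1)) ^ 2 * (radialX h₂ m r + radialY h h₁ h₂ m r) =
      r ^ (2 * lam + m - 2) * (2 * h₂ (r ^ 2) * r ^ 4 + 2 * (m + 1) * h₁ (r ^ 2) * r ^ 2 +
        m * (m + 1) * h (r ^ 2)) := by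
  obtain ⟨e1, e2, e3⟩ := rpow_mul_pow_relations lam m hr
  rw [radialX, radialY]
  linear_combination h₂ (r ^ 2) * e1 + (r ^ 2 * h₂ (r ^ 2) + (m + 2) * h₁ (r ^ 2)) * e2 +
    (r ^ 2 * h₁ (r ^ 2) + (m + 1) * h (r ^ 2)) * e3

theorem continuousOn_rpow_Icc (p : ℝ) :
    ContinuousOn (fun r : ℝ => r ^ p) (Set.Icc (1 / 2) 2) :=
  continuousOn_id.rpow_const fun r hr => Or.inl
    (lt_of_lt_of_le (by norm_num : (0 : ℝ) < 1 / 2) hr.1).ne'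

theorem continuousOn_radial {k : ℝ → ℝ} (hk : Continuous k) :
    ContinuousOn (fun r : ℝ => r * (r ^ (lam - 1)) ^ 2 * k r) (Set.Icc (1 / 2) 2) :=
  (continuousOn_id.mul ((continuousOn_rpow_Icc _).pow 2)).mul hk.continuousOn

theorem integral_radial_diff (hh : ∀ x, HasDerivAt h (h₁ x) x) (hc₁ : Continuous h₁)
    (hc₂ : Continuous h₂) (h0 : ∀ x ∉ Set.Icc (1 : ℝ) 2, h x = 0) :
    ∫ r in (1 / 2)..2, r * (r ^ (lam - 1)) ^ 2 * (radialX h₂ m r - radialY h h₁ h₂ m r) =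
      (2 * lam - 1) * (m + 1) * ∫ r in (1 / 2)..2, h (r ^ 2) * r ^ (2 * lam + m - 2) := by
  have hc : Continuous h := continuous_iff_continuousAt.mpr fun x => (hh x).continuousAt
  refine integral_eq_of_hasDerivAt_add
    (Φ := fun r => -((m : ℝ) + 1) * (h (r ^ 2) * r ^ (2 * lam + m - 1))) _ (fun r hr => ?_)
    (by simp only [h0 ((1 / 2) ^ 2) (by norm_num)]; ring)
    (by simp only [h0 (2 ^ 2) (by norm_num)]; ring)
    (continuousOn_radial _ (by unfold radialX radialY; fun_prop))
    ((Continuous.continuousOn (by fun_prop)).mul (continuousOn_rpow_Icc _))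
  rw [radial_diff_eq lam m hr]
  refine ((hasDerivAt_comp_sq_mul_rpow hh (2 * lam + m - 1) hr).const_mul _).congr_deriv ?_
  have e : r ^ (2 * lam + m - 2) = r ^ (2 * lam + m - 1 - 2) * r := by
    rw [← Real.rpow_add_one hr.ne']; ring_nf
  rw [e]; ring

theorem integral_radial_sum (hh : ∀ x, HasDerivAt h (h₁ x) x) (hh₁ : ∀ x, HasDerivAt h₁ (h₂ x) x)
    (hc₂ : Continuous h₂) (h0 : ∀ x ∉ Set.Icc (1 : ℝ) 2, h x = 0)
    (h10 : ∀ x ∉ Set.Icc (1 : ℝ) 2, h₁ x = 0) :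
    ∫ r in (1 / 2)..2, r * (r ^ (lam - 1)) ^ 2 * (radialX h₂ m r + radialY h h₁ h₂ m r) =
      (2 * lam ^ 2 - 2 * lam + ((m : ℝ) + 1) ^ 2 / 2) *
        ∫ r in (1 / 2)..2, h (r ^ 2) * r ^ (2 * lam + m - 2) := by
  have hc : Continuous h := continuous_iff_continuousAt.mpr fun x => (hh x).continuousAt
  have hc₁ : Continuous h₁ := continuous_iff_continuousAt.mpr fun x => (hh₁ x).continuousAt
  -- The coefficient `(m + 1 - 2λ)/2` is the one that matches the `h₁` terms: `(2λ + m + 1) + (m + 1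
  -- - 2λ) = 2(m + 1)`. The leftover multiple of `h` is the stated constant.
  refine integral_eq_of_hasDerivAt_add
    (Φ := fun r => h₁ (r ^ 2) * r ^ (2 * lam + m + 1) +
      ((m + 1 - 2 * lam) / 2) * (h (r ^ 2) * r ^ (2 * lam + m - 1))) _ (fun r hr => ?_)
    (by simp only [h0 ((1 / 2) ^ 2) (by norm_num), h10 ((1 / 2) ^ 2) (by norm_num)]; ring)
    (by simp only [h0 (2 ^ 2) (by norm_num), h10 (2 ^ 2) (by norm_num)]; ring)
    (continuousOn_radial _ (by unfold radialX radialY; fun_prop))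
    ((Continuous.continuousOn (by fun_prop)).mul (continuousOn_rpow_Icc _))
  rw [radial_sum_eq lam m hr]
  refine ((hasDerivAt_comp_sq_mul_rpow hh₁ (2 * lam + m + 1) hr).add
    ((hasDerivAt_comp_sq_mul_rpow hh (2 * lam + m - 1) hr).const_mul _)).congr_deriv ?_
  have e : r ^ (2 * lam + m - 2) = r ^ (2 * lam + m - 1 - 2) * r := by
    rw [← Real.rpow_add_one hr.ne']; ring_nf
  have e' : r ^ (2 * lam + m + 1 - 2) = r ^ (2 * lam + m - 1 - 2) * r ^ 2 := by
    rw [← Real.rpow_natCast, ← Real.rpow_add hr]; congr 1; push_cast; ring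
  rw [e, e']; ring

theorem integral_cutoff_pos (hc : Continuous h) (hn : ∀ x, 0 ≤ h x) (hp : 0 < h (3 / 2)) (p : ℝ) :
    0 < ∫ r in (1 / 2)..2, h (r ^ 2) * r ^ p := by
  have hs : (√(3 / 2)) ^ 2 = 3 / 2 := Real.sq_sqrt (by norm_num)
  have hs0 : 0 < √(3 / 2 : ℝ) := Real.sqrt_pos.mpr (by norm_num)
  refine intervalIntegral.integral_pos (by norm_num)
    ((Continuous.continuousOn (by fun_prop)).mul (continuousOn_rpow_Icc _)) (fun r hr => ?_)
    ⟨√(3 / 2), ⟨by nlinarith, by nlinarith⟩, ?_⟩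
  · exact mul_nonneg (hn _) (Real.rpow_nonneg (le_trans (by norm_num) hr.1.le) _)
  · rw [hs]; exact mul_pos hp (Real.rpow_pos_of_pos hs0 _)

end Radial

/-! ### The angular modes of the momentum equation -/

theorem setIntegral_polarCoord_target_two_modes {ρ₁ ρ₂ g₁ g₂ : ℝ → ℝ}
    (hρ₁ : IntegrableOn ρ₁ (Set.Ioi 0)) (hρ₂ : IntegrableOn ρ₂ (Set.Ioi 0))
    (hg₁ : IntervalIntegrable g₁ volume (-π) π) (hg₂ : IntervalIntegrable g₂ volume (-π) π) :
    ∫ p in polarCoord.target, -(ρ₁ p.1 * g₁ p.2 + ρ₂ p.1 * g₂ p.2) =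
      -((∫ r in Set.Ioi 0, ρ₁ r) * (∫ θ in (-π)..π, g₁ θ) +
        (∫ r in Set.Ioi 0, ρ₂ r) * ∫ θ in (-π)..π, g₂ θ) := by
  have hio : ∀ {g : ℝ → ℝ}, IntervalIntegrable g volume (-π) π →
      IntegrableOn g (Set.Ioo (-π) π) := fun hg =>
    (intervalIntegrable_iff_integrableOn_Ioo_of_le neg_pi_lt_pi.le).mp hg
  have hprod : ∀ {ρ g : ℝ → ℝ}, IntegrableOn ρ (Set.Ioi 0) → IntervalIntegrable g volume (-π) π →
      IntegrableOn (fun p : ℝ × ℝ => ρ p.1 * g p.2) (Set.Ioi 0 ×ˢ Set.Ioo (-π) π) := by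
    intro ρ g hρ hg
    rw [IntegrableOn, Measure.volume_eq_prod, ← Measure.prod_restrict]
    exact Integrable.mul_prod hρ (hio hg)
  have hval : ∀ ρ g : ℝ → ℝ, ∫ p in Set.Ioi 0 ×ˢ Set.Ioo (-π) π, ρ p.1 * g p.2 =
      (∫ r in Set.Ioi 0, ρ r) * ∫ θ in (-π)..π, g θ := by
    intro ρ g
    rw [Measure.volume_eq_prod, setIntegral_prod_mul,
      intervalIntegral.integral_of_le neg_pi_lt_pi.le, integral_Ioc_eq_integral_Ioo]
  rw [polarCoord_target, MeasureTheory.integral_neg, MeasureTheory.integral_add (hprod hρ₁ hg₁) (hprod hρ₂ hg₂), hval, hval]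

/-- The test field is solenoidal, so the pressure drops out. In polar coordinates the integrand is a
sum of two products of a radial and an angular factor, and both radial integrals are multiples of
the same positive number, which is cancelled at the end. -/
theorem IsWeakStationaryEuler.mode_identity {lam : ℝ} {ψ dψ : ℝ → ℝ} (hψ : IsH1Circle ψ dψ)
    {p : 𝓓'(puncturedPlane, ℝ)}
    (hE : IsWeakStationaryEuler puncturedPlane (homVelocity lam ψ dψ) p) (m : ℕ) (c : ℂ) :
    (2 * lam - 1) * (m + 1) * (∫ θ in (-π)..π, (dψ θ ^ 2 - (lam * ψ θ) ^ 2) *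
        (c * ((Real.cos θ : ℂ) + Real.sin θ * Complex.I) ^ (m + 1)).im) +
      (2 * lam ^ 2 - 2 * lam + ((m : ℝ) + 1) ^ 2 / 2) * (∫ θ in (-π)..π, 2 * (lam * ψ θ) * dψ θ *
        (c * ((Real.cos θ : ℂ) + Real.sin θ * Complex.I) ^ (m + 1)).re) = 0 := by
  obtain ⟨h, h₁, h₂, hs, hs₁, hc₂, hh, hh₁, hn, hp, h0, h10, h20⟩ := exists_radial_cutoff
  have hψc := hψ.continuous
  have hmom := hE.momentum (modeTestField h h₁ hs hs₁ h0 h10 m c)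
  rw [divergence_modeTestField hs hs₁ h0 h10 hh hh₁, map_zero, add_zero,
    ← Complex.integral_comp_polarCoord_symm] at hmom
  set ρ₁ : ℝ → ℝ := fun r => r * (r ^ (lam - 1)) ^ 2 * (radialX h₂ m r - radialY h h₁ h₂ m r)
    with hρ₁
  set ρ₂ : ℝ → ℝ := fun r => r * (r ^ (lam - 1)) ^ 2 * (radialX h₂ m r + radialY h h₁ h₂ m r)
    with hρ₂
  set g₁ : ℝ → ℝ := fun θ => (dψ θ ^ 2 - (lam * ψ θ) ^ 2) *
    (c * ((Real.cos θ : ℂ) + Real.sin θ * Complex.I) ^ (m + 1)).im with hg₁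
  set g₂ : ℝ → ℝ := fun θ => 2 * (lam * ψ θ) * dψ θ *
    (c * ((Real.cos θ : ℂ) + Real.sin θ * Complex.I) ^ (m + 1)).re with hg₂
  have hpolar : ∫ q in polarCoord.target, q.1 • inner ℝ
      (fderiv ℝ (modeTestField h h₁ hs hs₁ h0 h10 m c) (Complex.polarCoord.symm q)
        (homVelocity lam ψ dψ (Complex.polarCoord.symm q)))
      (homVelocity lam ψ dψ (Complex.polarCoord.symm q)) =
      ∫ q in polarCoord.target, -(ρ₁ q.1 * g₁ q.2 + ρ₂ q.1 * g₂ q.2) := by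
    refine setIntegral_congr_fun polarCoord.open_target.measurableSet fun q hq => ?_
    obtain ⟨r, θ⟩ := q
    have hr : 0 < r := hq.1
    have hθ : θ ∈ Set.Ioc (-π) π := Set.Ioo_subset_Ioc_self hq.2
    change r • inner ℝ (fderiv ℝ (modeField h h₁ m c) (Complex.polarCoord.symm (r, θ))
        (homVelocity lam ψ dψ (Complex.polarCoord.symm (r, θ))))
      (homVelocity lam ψ dψ (Complex.polarCoord.symm (r, θ))) =
      -(ρ₁ r * g₁ θ + ρ₂ r * g₂ θ)
    have hunit : ((Real.cos θ : ℂ) + Real.sin θ * Complex.I) *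
        conj ((Real.cos θ : ℂ) + Real.sin θ * Complex.I) = 1 := by
      rw [Complex.mul_conj, Complex.normSq_add_mul_I, Real.cos_sq_add_sin_sq, Complex.ofReal_one]
    have hns : Complex.normSq (r * ((Real.cos θ : ℂ) + Real.sin θ * Complex.I)) = r ^ 2 := by
      rw [map_mul, Complex.normSq_ofReal, Complex.normSq_add_mul_I, Real.cos_sq_add_sin_sq]; ring
    rw [inner_fderiv_modeField hs hs₁ hh hh₁, Complex.polarCoord_symm_apply,
      homVelocity_polar lam ψ dψ hr hθ, hns]
    have key := mode_mul_conj_sq m r hunit c (h₂ (r ^ 2))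
      (r ^ 2 * h₂ (r ^ 2) + (m + 2) * h₁ (r ^ 2))
      (r ^ 2 * h₁ (r ^ 2) + (m + 1) * h (r ^ 2)) (r ^ (lam - 1)) (dψ θ) (lam * ψ θ)
    rw [Complex.ofReal_mul lam] at key
    rw [key]
    simp only [hρ₁, hρ₂, hg₁, hg₂, radialX, radialY, smul_eq_mul]
    ring
  rw [hpolar] at hmom
  have hd2 := hψ.intervalIntegrable_sq
  have hrad : ∀ r, 0 < r → r ∉ Set.Ioc (1 / 2 : ℝ) 2 → radialX h₂ m r = 0 ∧
      radialY h h₁ h₂ m r = 0 := fun r hr hr' => by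
    have := sq_notMem_Icc hr hr'
    simp [radialX, radialY, h0 _ this, h10 _ this, h20 _ this]
  have hz₁ : ∀ r, 0 < r → r ∉ Set.Ioc (1 / 2 : ℝ) 2 → ρ₁ r = 0 := fun r hr hr' => by
    simp [hρ₁, hrad r hr hr']
  have hz₂ : ∀ r, 0 < r → r ∉ Set.Ioc (1 / 2 : ℝ) 2 → ρ₂ r = 0 := fun r hr hr' => by
    simp [hρ₂, hrad r hr hr']
  have hch := hs.continuous
  have hch₁ := hs₁.continuous
  have hE1 : Continuous fun θ : ℝ =>
      (c * ((Real.cos θ : ℂ) + Real.sin θ * Complex.I) ^ (m + 1)).im :=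
    Complex.continuous_im.comp (by fun_prop)
  have hE2 : Continuous fun θ : ℝ =>
      (c * ((Real.cos θ : ℂ) + Real.sin θ * Complex.I) ^ (m + 1)).re :=
    Complex.continuous_re.comp (by fun_prop)
  have hi₁ : IntervalIntegrable g₁ volume (-π) π :=
    (hd2.sub (Continuous.intervalIntegrable (by fun_prop) _ _)).mul_continuousOn hE1.continuousOn
  have hi₂ : IntervalIntegrable g₂ volume (-π) π :=
    (hψ.intervalIntegrable.continuousOn_mul (Continuous.continuousOn (by fun_prop))).mul_continuousOn
      hE2.continuousOn
  rw [setIntegral_polarCoord_target_two_modes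
    (integrableOn_Ioi_of_support hz₁
      (continuousOn_radial _ (by unfold radialX radialY; fun_prop)))
    (integrableOn_Ioi_of_support hz₂
      (continuousOn_radial _ (by unfold radialX radialY; fun_prop)))
    hi₁ hi₂,
    setIntegral_Ioi_eq_intervalIntegral hz₁, setIntegral_Ioi_eq_intervalIntegral hz₂,
    integral_radial_diff lam m hh hch₁ hc₂ h0, integral_radial_sum lam m hh hh₁ hc₂ h0 h10] at hmom
  refine mul_left_cancel₀ (integral_cutoff_pos hch hn hp (2 * lam + m - 2)).ne' ?_
  linear_combination -hmom

theorem IsWeakStationaryEuler.isModeSolution {lam : ℝ} {ψ dψ : ℝ → ℝ} (hψ : IsH1Circle ψ dψ)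
    {p : 𝓓'(puncturedPlane, ℝ)}
    (hE : IsWeakStationaryEuler puncturedPlane (homVelocity lam ψ dψ) p) :
    IsModeSolution lam ψ dψ := by
  have hpow : ∀ (m : ℕ) (θ : ℝ), ((Real.cos θ : ℂ) + Real.sin θ * Complex.I) ^ (m + 1) =
      ⟨Real.cos ((m + 1 : ℕ) * θ), Real.sin ((m + 1 : ℕ) * θ)⟩ := by
    intro m θ
    rw [Complex.ofReal_cos, Complex.ofReal_sin, Complex.cos_add_sin_mul_I_pow,
      ← Complex.ofReal_natCast, ← Complex.ofReal_mul, ← Complex.ofReal_cos, ← Complex.ofReal_sin]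
    generalize Real.cos _ = C
    generalize Real.sin _ = S
    apply Complex.ext <;> simp
  have hT : ∀ w : ℝ → ℝ, ∫ θ in (-π)..π, 2 * (lam * ψ θ) * dψ θ * w θ =
      2 * lam * ∫ θ in (-π)..π, ψ θ * dψ θ * w θ := fun w => by
    rw [← intervalIntegral.integral_const_mul]
    congr 1; ext θ; ring
  constructor
  · intro n hn
    obtain ⟨m, rfl⟩ : ∃ m, n = m + 1 := ⟨n - 1, by omega⟩
    -- With `c = i` the imaginary and real parts of `c e^{inθ}` are `cos nθ` and `-sin nθ`; with `c
    -- = 1` they are `sin nθ` and `cos nθ`.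
    have := hE.mode_identity hψ m Complex.I
    simp_rw [hpow] at this
    simp only [Complex.mul_im, Complex.mul_re, Complex.I_re, Complex.I_im, zero_mul, one_mul,
      zero_add, zero_sub, mul_neg, intervalIntegral.integral_neg, mul_pow] at this
    rw [hT] at this
    push_cast at this ⊢
    linear_combination this
  · intro n hn
    obtain ⟨m, rfl⟩ : ∃ m, n = m + 1 := ⟨n - 1, by omega⟩
    have := hE.mode_identity hψ m 1
    simp_rw [hpow, one_mul, mul_pow] at this
    rw [hT] at this
    push_cast at this ⊢
    linear_combination this

end HomEuler

end

theorem mainTheorem3 (lam : ℝ) (hlam : 0 < lam) (hlam' : lam < 1 / 2) (ψ dψ : ℝ → ℝ)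
    (hψ : HomEuler.IsH1Circle ψ dψ)
    (hEuler : ∃ p : 𝓓'(HomEuler.puncturedPlane, ℝ),
      HomEuler.IsWeakStationaryEuler HomEuler.puncturedPlane
        (HomEuler.homVelocity lam ψ dψ) p) :
    HomEuler.IsTrivial lam ψ ∧
      ((∀ θ, ψ θ = 0) ∨ HomEuler.IsElliptic ψ) ∧
      ¬ HomEuler.IsHyperbolic lam ψ ∧
      ¬ HomEuler.IsParabolic ψ ∧
      (HomEuler.IsElliptic ψ → HomEuler.IsRotational ψ) := by
  obtain ⟨p, hE⟩ := hEuler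
  exact ((hE.isModeSolution hψ).isRotational hlam hlam' hψ).classification
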